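/- \textbf{Setting.} Let $\mathcal X,\mathcal S,\mathcal Y,\mathcal Y_1$ be finite non-empty alphabets, let $W(y,y_1|x,s)$ be the transition law of a state-dependent discrete memoryless primitive relay channel, and let $C_1\ge 0$ be the rate of the noiseless link from the relay to the receiver. Let $\mathcal Q$ be a non-empty compact convex set of pmfs on $\mathcal S$. In the compound channel the state sequence is i.i.d. $\sim q$ with $q\in\mathcal Q$ unknown. A $(2^{nR},n)$ code consists of an encoder $f:[1:2^{nR}]\to\mathcal X^n$, a relaying function $f_1:\mathcal Y_1^n\to[1:2^{nC_1}]$ and a decoder $g:\mathcal Y^n\times[1:2^{nC_1}]\to[1:2^{nR}]$, where $2^{nR}$ is rounded up and $2^{nC_1}$ is rounded down to an integer. Its error probability $P_e(q)$ is the probability that $g(Y^n,f_1(Y_1^n))\ne M$ when $M$ is uniform, $X^n=f(M)$, the state sequence is i.i.d. $\sim q$ and independent of $M$, and $(Y^n,Y_1^n)\sim\prod_i W(y_i,y_{1,i}|x_i,s_i)$. A rate $R\ge 0$ is achievable if for every $\varepsilon>0$ and all sufficiently large $n$ there is such a code with $P_e(q)\le\varepsilon$ for all $q\in\mathcal Q$;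 the capacity $\mathbb C$ is the supremum of the achievable rates. For $q\in\mathcal Q$ let $I_q$ denote mutual information (in bits) when $(U,X,Y,Y_1)\sim p(u,x)\sum_s q(s)W(y,y_1|x,s)$. Define the cutset bound $$\mathsf R_{CS}=\inf_{q\in\mathcal Q}\max_{p(x)}\min\{I_q(X;Y)+C_1,\; I_q(X;Y,Y_1)\}$$ and the decode-forward bound $$\mathsf R_{DF}=\max_{p(u,x)}\min\Big\{\inf_{q\in\mathcal Q} I_q(U;Y)+\inf_{q\in\mathcal Q} I_q(X;Y|U)+C_1,\;\inf_{q\in\mathcal Q} I_q(U;Y_1)+\inf_{q\in\mathcal Q} I_q(X;Y|U)\Big\},$$ where $U$ ranges over all finite alphabets. \textbf{Statement.} \begin{enumerate} \item If the channel is reversely strongly degraded, i.e. $W(y,y_1|x,s)=W_{Y|X,S}(y|x,s)\,W_{Y_1|Y}(y_1|y)$ for some conditional pmfs $W_{Y|X,S}$, $W_{Y_1|Y}$, then $$\mathbb C=\mathsf R_{DF}=\mathsf R_{CS}=\min_{q\in\mathcal Q}\max_{p(x)} I_q(X;Y).$$ \item If the channel is strongly degraded, i.e. $W(y,y_1|x,s)=W_{Y_1|X}(y_1|x)\,W_{Y|Y_1,S}(y|y_1,s)$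 for some conditional pmfs $W_{Y_1|X}$, $W_{Y|Y_1,S}$, then $$\mathbb C=\mathsf R_{DF}=\mathsf R_{CS}=\max_{p(x)}\min\Big\{\min_{q\in\mathcal Q} I_q(X;Y)+C_1,\; I(X;Y_1)\Big\},$$ where $I(X;Y_1)$ is computed under $p(x)W_{Y_1|X}(y_1|x)$. \end{enumerate} The suprema and infima written as maxima and minima are attained. -/

import Mathlib

open scoped BigOperators

noncomputable section

namespace PrimRelay

/-! Finite-alphabet pmfs are points of `stdSimplex ℝ α`; logarithms are to base 2. -/

/-- Mutual information `I(A;B)` in bits of a joint pmf `P` on `A × B`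
(terms with `P (a, b) = 0` contribute `0`). -/
def mutualInfo {A B : Type*} [Fintype A] [Fintype B] (P : A × B → ℝ) : ℝ :=
  ∑ a, ∑ b, P (a, b) * Real.logb 2 (P (a, b) / ((∑ b', P (a, b')) * (∑ a', P (a', b))))

/-- Conditional mutual information `I(A;B|U)` in bits of a joint pmf `P u a b`. -/
def condMutualInfo {U A B : Type*} [Fintype U] [Fintype A] [Fintype B]
    (P : U → A → B → ℝ) : ℝ :=
  ∑ u, ∑ a, ∑ b, P u a b *
    Real.logb 2 ((P u a b * ∑ a', ∑ b', P u a' b') / ((∑ b', P u a b') * (∑ a', P u a' b)))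

/-- `I(X;B)` for an input pmf `p` and a channel `K` from `X` to `B`. -/
def channelInfo {X B : Type*} [Fintype X] [Fintype B] (p : X → ℝ) (K : X → B → ℝ) : ℝ :=
  mutualInfo (fun z : X × B => p z.1 * K z.1 z.2)

/-- `I(U;B)` for a joint pmf `p` of `(U, X)` and a channel `K` from `X` to `B`,
with `U - X - B` a Markov chain. -/
def auxInfo {U X B : Type*} [Fintype U] [Fintype X] [Fintype B]
    (p : U × X → ℝ) (K : X → B → ℝ) : ℝ :=
  mutualInfo (fun z : U × B => ∑ x, p (z.1, x) * K x z.2)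

/-- `I(X;B|U)` for a joint pmf `p` of `(U, X)` and a channel `K` from `X` to `B`,
with `U - X - B` a Markov chain. -/
def condInfo {U X B : Type*} [Fintype U] [Fintype X] [Fintype B]
    (p : U × X → ℝ) (K : X → B → ℝ) : ℝ :=
  condMutualInfo (fun u x b => p (u, x) * K x b)

/-- The transition law `W(y, y₁ | x, s)` of a state-dependent discrete memoryless primitive
relay channel with input alphabet `X`, state alphabet `S`, output alphabet `Y` and relay
input alphabet `Y₁`. -/
structure Channel (X S Y Y₁ : Type*) [Fintype Y] [Fintype Y₁] where
  W : X → S → Y × Y₁ → ℝ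
  mem_simplex : ∀ x s, W x s ∈ stdSimplex ℝ (Y × Y₁)

/-- A code of block length `n` with `M` messages and `L` relay indices: an encoder, a relaying
function and a decoder. -/
structure Code (X Y Y₁ : Type*) (n M L : ℕ) where
  enc : Fin M → (Fin n → X)
  relay : (Fin n → Y₁) → Fin L
  dec : (Fin n → Y) → Fin L → Fin M

namespace Channel

variable {X S Y Y₁ : Type*} [Fintype X] [Fintype S] [Fintype Y] [Fintype Y₁]

/-- `W(y, y₁ | x, s) = W(y | x, s) W(y₁ | y)`: reversely degraded, with a channel from `Y` to
`Y₁` that does not depend on the state. -/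
def IsReverselyStronglyDegraded (W : Channel X S Y Y₁) : Prop :=
  ∃ (K : X → S → Y → ℝ) (V : Y → Y₁ → ℝ),
    (∀ x s, K x s ∈ stdSimplex ℝ Y) ∧ (∀ y, V y ∈ stdSimplex ℝ Y₁) ∧
      ∀ x s y y₁, W.W x s (y, y₁) = K x s y * V y y₁

/-- `W(y, y₁ | x, s) = W₁(y₁ | x) W(y | y₁, s)`: strongly degraded, with state-independent
channel `W₁` from `X` to `Y₁`. -/
def IsStronglyDegradedWith (W : Channel X S Y Y₁) (W₁ : X → Y₁ → ℝ) : Prop :=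
  (∀ x, W₁ x ∈ stdSimplex ℝ Y₁) ∧
    ∃ V : Y₁ → S → Y → ℝ, (∀ y₁ s, V y₁ s ∈ stdSimplex ℝ Y) ∧
      ∀ x s y y₁, W.W x s (y, y₁) = W₁ x y₁ * V y₁ s y

/-- The channel from `X` to `(Y, Y₁)` induced by a state distributed according to `q`. -/
def avg (W : Channel X S Y Y₁) (q : S → ℝ) (x : X) (z : Y × Y₁) : ℝ :=
  ∑ s, q s * W.W x s z

/-- The induced channel from `X` to `Y`. -/
def avgY (W : Channel X S Y Y₁) (q : S → ℝ) (x : X) (y : Y) : ℝ :=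
  ∑ y₁, W.avg q x (y, y₁)

/-- The induced channel from `X` to `Y₁`. -/
def avgY₁ (W : Channel X S Y Y₁) (q : S → ℝ) (x : X) (y₁ : Y₁) : ℝ :=
  ∑ y, W.avg q x (y, y₁)

/-! ### Operational capacity of the compound channel -/

/-- Average (over messages) probability of error given the state sequence `s`. -/
def condError (W : Channel X S Y Y₁) {n M L : ℕ} (c : Code X Y Y₁ n M L)
    (s : Fin n → S) : ℝ :=
  (1 / (M : ℝ)) * ∑ m : Fin M, ∑ y : Fin n → Y, ∑ y₁ : Fin n → Y₁,
    if c.dec y (c.relay y₁) ≠ m then ∏ i, W.W (c.enc m i) (s i) (y i, y₁ i) else 0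

/-- Average probability of error when the state sequence is i.i.d. according to `q`. -/
def error (W : Channel X S Y Y₁) {n M L : ℕ} (c : Code X Y Y₁ n M L) (q : S → ℝ) : ℝ :=
  ∑ s : Fin n → S, (∏ i, q (s i)) * W.condError c s

/-- `R ≥ 0` is achievable over the compound channel: for every `ε > 0` and all large enough `n`
there is a code with `2^{nR}` messages (rounded up) and `2^{nC₁}` relay indices (rounded down)
whose error probability is at most `ε` for every `q ∈ Q`. -/
def Achievable (W : Channel X S Y Y₁) (C₁ : ℝ) (Q : Set (S → ℝ)) (R : ℝ) : Prop :=
  0 ≤ R ∧ ∀ ε : ℝ, 0 < ε → ∃ N : ℕ, ∀ n : ℕ, N ≤ n →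
    ∃ c : Code X Y Y₁ n ⌈(2 : ℝ) ^ ((n : ℝ) * R)⌉₊ ⌊(2 : ℝ) ^ ((n : ℝ) * C₁)⌋₊,
      ∀ q ∈ Q, W.error c q ≤ ε

/-- The capacity: the supremum of the achievable rates. -/
def capacity (W : Channel X S Y Y₁) (C₁ : ℝ) (Q : Set (S → ℝ)) : ℝ :=
  sSup {R | W.Achievable C₁ Q R}

/-! ### The cutset and decode-forward bounds -/

/-- `min {I_q(X;Y) + C₁, I_q(X;Y,Y₁)}`. -/
def cutsetObjective (W : Channel X S Y Y₁) (C₁ : ℝ) (q : S → ℝ) (p : X → ℝ) : ℝ :=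
  min (channelInfo p (W.avgY q) + C₁) (channelInfo p (W.avg q))

/-- `inf_{q ∈ Q} max_{p(x)} min {I_q(X;Y) + C₁, I_q(X;Y,Y₁)}`. -/
def cutsetBound (W : Channel X S Y Y₁) (C₁ : ℝ) (Q : Set (S → ℝ)) : ℝ :=
  ⨅ q : Q, ⨆ p : stdSimplex ℝ X, W.cutsetObjective C₁ q.1 p.1

/-- `min {inf_q I_q(U;Y) + inf_q I_q(X;Y|U) + C₁, inf_q I_q(U;Y₁) + inf_q I_q(X;Y|U)}`. -/
def dfObjective (W : Channel X S Y Y₁) (C₁ : ℝ) (Q : Set (S → ℝ)) {U : Type*} [Fintype U]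
    (p : U × X → ℝ) : ℝ :=
  min ((⨅ q : Q, auxInfo p (W.avgY q.1)) + (⨅ q : Q, condInfo p (W.avgY q.1)) + C₁)
    ((⨅ q : Q, auxInfo p (W.avgY₁ q.1)) + (⨅ q : Q, condInfo p (W.avgY q.1)))

/-- The values of the decode-forward objective over all pmfs `p(u, x)` with `U` in an arbitrary
finite alphabet. -/
def dfValues (W : Channel X S Y Y₁) (C₁ : ℝ) (Q : Set (S → ℝ)) : Set ℝ :=
  {v | ∃ (k : ℕ) (p : Fin k × X → ℝ), p ∈ stdSimplex ℝ (Fin k × X) ∧ v = W.dfObjective C₁ Q p}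

/-- The decode-forward bound. -/
def dfBound (W : Channel X S Y Y₁) (C₁ : ℝ) (Q : Set (S → ℝ)) : ℝ :=
  sSup (W.dfValues C₁ Q)

end Channel

end PrimRelay

end

open PrimRelay

/-!
Both parts have the same structure. Mutual information `I_q(X;Y)` is concave in the input law and
convex in the state law, so Sion's theorem gives a saddle point `(q*, p*)` of the single-letter
objective: `I_q(X;Y)` in the reversely degraded case, and `min {I_q(X;Y) + C₁, I(X;Y₁)}`, which is
quasiconvex in `q`, in the degraded case. Its value `v` is at once the cutset bound, the
decode-forward bound and the capacity.

* *Cutset bound.* In both cases the degradedness turns the cutset objective into the saddle function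
  (`channelInfo_eq_of_factor`), so minimax gives the value `v`.
* *Decode-forward bound.* At `q = q*` the chain rule `I(U;Y) + I(X;Y|U) = I(X;Y)` and data
  processing bound every decode-forward value by the saddle function at `(q*, p)`, hence by `v`. The
  value `v` is attained with `U` constant in the reversely degraded case and with `U = X` in the
  degraded case, in both cases with `X` distributed according to `p*`.
* *Converse.* The receiver knows `Y^n` and one of `2^(nC₁)` relay indices, so from `Y^n` alone it
  decodes a list of that size. Comparing the joint law of message and output with the product of the
  uniform law and an i.i.d. law `r^n`, with `r` the output law induced by the average letter
  composition of the codebook, bounds the rate by a single-letter mutual information without any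
  multi-letter chain rule (`log_mul_success_le`). The same composition serves both cuts
  (`exists_le_cutsetObjective`).
* *Achievability.* An i.i.d. codebook of law `p*` is decoded by a threshold test on finitely many
  information-density metrics, which by compactness suffice for all `q ∈ Q` (`exists_test`). One
  codebook must serve all `q` simultaneously: i.i.d. laws of the state sequence are dominated by a
  single weight of polynomial mass (`exists_weight_dominating_iid`), which the exponentially small
  mean number of competing codewords absorbs (`sum_mul_failureWeight_le`). In the degraded case the
  relay decodes the message and sends its residue modulo the number of relay indices, and the
  receiver decodes within that residue class (`achievable_of_lt_relay`).
-/

namespace PrimRelay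

open Real

/-! ### Log-sum inequality and data processing -/

/-- The tangent-line inequality `log t ≤ t - 1`, in the form in which it underlies every
information inequality below. -/
lemma sub_le_mul_log_div {u v : ℝ} (hu : 0 ≤ u) (hv : 0 ≤ v) (h : v = 0 → u = 0) :
    u - v ≤ u * log (u / v) := by
  rcases hu.eq_or_lt with rfl | hu'
  · simpa using hv
  have hv' : 0 < v := lt_of_le_of_ne hv fun h0 => hu'.ne' (h h0.symm)
  have h1 := log_le_sub_one_of_pos (div_pos hv' hu')
  have h2 : log (u / v) = - log (v / u) := by rw [← log_inv, inv_div]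
  rw [h2]
  have h3 : u * log (v / u) ≤ u * (v / u - 1) := mul_le_mul_of_nonneg_left h1 hu
  have h4 : u * (v / u - 1) = v - u := by field_simp
  linarith

lemma log_sum_le {ι : Type*} (s : Finset ι) (u v : ι → ℝ) (hu : ∀ i ∈ s, 0 ≤ u i)
    (hv : ∀ i ∈ s, 0 ≤ v i) (h : ∀ i ∈ s, v i = 0 → u i = 0) :
    (∑ i ∈ s, u i) * log ((∑ i ∈ s, u i) / ∑ i ∈ s, v i) ≤ ∑ i ∈ s, u i * log (u i / v i) := by
  rcases (Finset.sum_nonneg hu).eq_or_lt with h0 | hU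
  · have hz := (Finset.sum_eq_zero_iff_of_nonneg hu).1 h0.symm
    rw [← h0, zero_mul]
    exact Finset.sum_nonneg fun i hi => by rw [hz i hi, zero_mul]
  have hV : 0 < ∑ i ∈ s, v i := by
    refine lt_of_le_of_ne (Finset.sum_nonneg hv) fun h0 => hU.ne' ?_
    have hz := (Finset.sum_eq_zero_iff_of_nonneg hv).1 h0.symm
    exact Finset.sum_eq_zero fun i hi => h i hi (hz i hi)
  set t := (∑ i ∈ s, u i) / ∑ i ∈ s, v i with ht
  have htpos : 0 < t := div_pos hU hV
  have key : ∀ i ∈ s, u i - t * v i ≤ u i * log (u i / v i) - u i * log t := by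
    intro i hi
    rcases (hu i hi).eq_or_lt with h0 | hpos
    · rw [← h0]
      have := mul_nonneg htpos.le (hv i hi)
      simpa using this
    have hvpos : 0 < v i := lt_of_le_of_ne (hv i hi) fun h0 => hpos.ne' (h i hi h0.symm)
    have := sub_le_mul_log_div (hu i hi) (mul_pos htpos hvpos).le
      fun h0 => absurd h0 (mul_pos htpos hvpos).ne'
    rwa [mul_comm t, ← div_div, log_div (div_pos hpos hvpos).ne' htpos.ne', mul_sub,
      mul_comm (v i)] at this
  have := Finset.sum_le_sum key
  rw [Finset.sum_sub_distrib, Finset.sum_sub_distrib, ← Finset.mul_sum, ← Finset.sum_mul] at this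
  have h4 : t * ∑ i ∈ s, v i = ∑ i ∈ s, u i := by rw [ht]; field_simp
  linarith

/-- `∑ P(a,b) log (κ P(a,b) / (P(a) P(b)))` in nats, for a nonnegative weight `P` that need not be
normalized. With `κ = 1` it is mutual information; with `κ` the total mass of `P` it is one
summand of conditional mutual information. -/
noncomputable def infoSum {A B : Type*} [Fintype A] [Fintype B] (κ : ℝ) (P : A → B → ℝ) : ℝ :=
  ∑ a, ∑ b, P a b * log ((P a b * κ) / ((∑ b', P a b') * ∑ a', P a' b))

section

variable {A B C : Type*} [Fintype A] [Fintype B] [Fintype C]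

/-- The data processing inequality. -/
lemma infoSum_comp_le {κ : ℝ} (hκ : 0 ≤ κ) {P : A → B → ℝ} (hP : ∀ a b, 0 ≤ P a b)
    {V : B → C → ℝ} (hV : ∀ b, V b ∈ stdSimplex ℝ C) (h0 : κ = 0 → P = 0) :
    infoSum κ (fun a c => ∑ b, P a b * V b c) ≤ infoSum κ P := by
  rcases hκ.eq_or_lt with h | hκ
  · rw [h0 h.symm]; simp [infoSum]
  have hVn : ∀ b c, 0 ≤ V b c := fun b => (hV b).1
  have hrow : ∀ a, ∑ c, ∑ b, P a b * V b c = ∑ b, P a b := by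
    intro a
    rw [Finset.sum_comm]
    exact Finset.sum_congr rfl fun b _ => by rw [← Finset.mul_sum, (hV b).2, mul_one]
  have hcol : ∀ c, ∑ a, ∑ b, P a b * V b c = ∑ b, (∑ a, P a b) * V b c := by
    intro c
    rw [Finset.sum_comm]
    exact Finset.sum_congr rfl fun b _ => by rw [Finset.sum_mul]
  unfold infoSum
  refine Finset.sum_le_sum fun a _ => ?_
  have hR : ∀ b, P a b * log ((P a b * κ) / ((∑ b', P a b') * ∑ a', P a' b)) =
      ∑ c, (P a b * V b c) * log ((P a b * V b c) /
        ((∑ b', P a b') / κ * ((∑ a', P a' b) * V b c))) := by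
    intro b
    rw [← mul_one (P a b * log _), ← (hV b).2, Finset.mul_sum]
    refine Finset.sum_congr rfl fun c _ => ?_
    rcases (hVn b c).eq_or_lt with hz | hz
    · simp [← hz]
    have : (P a b * V b c) / ((∑ b', P a b') / κ * ((∑ a', P a' b) * V b c)) =
        (P a b * κ) / ((∑ b', P a b') * ∑ a', P a' b) := by
      rw [← mul_assoc, mul_div_mul_right _ _ hz.ne', div_mul_eq_mul_div, div_div_eq_mul_div]
    rw [this]; ring
  rw [Finset.sum_congr rfl fun b _ => hR b]
  refine le_of_le_of_eq (Finset.sum_le_sum fun c _ => ?_) Finset.sum_comm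
  have hv : ∀ b, 0 ≤ (∑ b', P a b') / κ * ((∑ a', P a' b) * V b c) := fun b =>
    mul_nonneg (div_nonneg (Finset.sum_nonneg fun _ _ => hP _ _) hκ.le)
      (mul_nonneg (Finset.sum_nonneg fun _ _ => hP _ _) (hVn b c))
  have := log_sum_le Finset.univ (fun b => P a b * V b c)
    (fun b => (∑ b', P a b') / κ * ((∑ a', P a' b) * V b c))
    (fun b _ => mul_nonneg (hP a b) (hVn b c)) (fun b _ => hv b) (by
      intro b _ h
      rcases mul_eq_zero.1 h with h | h
      · have h' := (div_eq_zero_iff.1 h).resolve_right hκ.ne'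
        have := (Finset.sum_eq_zero_iff_of_nonneg fun b' _ => hP a b').1 h' b (Finset.mem_univ b)
        simp [this]
      · rcases mul_eq_zero.1 h with h | h
        · have := (Finset.sum_eq_zero_iff_of_nonneg fun a' _ => hP a' b).1 h a (Finset.mem_univ a)
          simp [this]
        · simp [h])
  refine le_trans (le_of_eq ?_) this
  rw [hrow a, hcol c, ← Finset.mul_sum, mul_div_assoc, div_mul_eq_mul_div, div_div_eq_mul_div,
    mul_div_assoc]

/-- Nonnegativity of information: data processing down to a one-letter alphabet. -/
lemma infoSum_nonneg {P : A → B → ℝ} (hP : ∀ a b, 0 ≤ P a b) :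
    0 ≤ infoSum (∑ a, ∑ b, P a b) P := by
  have hκ : 0 ≤ ∑ a, ∑ b, P a b := Finset.sum_nonneg fun _ _ => Finset.sum_nonneg fun _ _ => hP _ _
  refine le_trans (le_of_eq ?_)
    (infoSum_comp_le (C := Unit) hκ hP (V := fun _ _ => 1) (by simp [stdSimplex]) ?_)
  · unfold infoSum
    symm
    refine Finset.sum_eq_zero fun a _ => ?_
    simp only [mul_one, Finset.univ_unique, Finset.sum_const, Finset.card_singleton, one_smul]
    rcases eq_or_ne ((∑ b, P a b) * ∑ a, ∑ b, P a b) 0 with h | h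
    · simp [h]
    · simp [div_self h]
  · intro h
    funext a b
    have h1 := (Finset.sum_eq_zero_iff_of_nonneg
      fun a _ => Finset.sum_nonneg fun b _ => hP a b).1 h a (Finset.mem_univ a)
    exact (Finset.sum_eq_zero_iff_of_nonneg fun b _ => hP a b).1 h1 b (Finset.mem_univ b)

lemma logb_two_mul_log_two (z : ℝ) : logb 2 z * log 2 = log z := by
  rw [logb, div_mul_cancel₀ _ (log_pos one_lt_two).ne']

lemma mutualInfo_mul_log_two (P : A × B → ℝ) :
    mutualInfo P * log 2 = infoSum 1 fun a b => P (a, b) := by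
  simp only [mutualInfo, infoSum, Finset.sum_mul, mul_assoc, logb_two_mul_log_two, mul_one]

lemma condMutualInfo_mul_log_two {U : Type*} [Fintype U] (P : U → A → B → ℝ) :
    condMutualInfo P * log 2 = ∑ u, infoSum (∑ a, ∑ b, P u a b) (P u) := by
  simp only [condMutualInfo, infoSum, Finset.sum_mul, mul_assoc, logb_two_mul_log_two]

/-! ### Entropy expansions -/

/-- Entropy in nats, extended to arbitrary real weights. -/
noncomputable def entropy (f : A → ℝ) : ℝ := ∑ a, negMulLog (f a)

lemma continuous_entropy : Continuous (entropy : (A → ℝ) → ℝ) :=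
  continuous_finsetSum _ fun a _ => continuous_negMulLog.comp (continuous_apply a)

lemma entropy_smul (t : ℝ) (f : A → ℝ) :
    entropy (fun a => t * f a) = negMulLog t * ∑ a, f a + t * entropy f := by
  simp only [entropy, negMulLog_mul, Finset.sum_add_distrib, Finset.mul_sum]
  congr 1
  exact Finset.sum_congr rfl fun a _ => mul_comm _ _

lemma infoSum_eq_entropy {κ : ℝ} (hκ : 0 < κ) {P : A → B → ℝ} (hP : ∀ a b, 0 ≤ P a b) :
    infoSum κ P = entropy (fun a => ∑ b, P a b) + entropy (fun b => ∑ a, P a b)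
      - entropy (fun z : A × B => P z.1 z.2) + (∑ a, ∑ b, P a b) * log κ := by
  have hterm : ∀ a b, P a b * log ((P a b * κ) / ((∑ b', P a b') * ∑ a', P a' b)) =
      -(P a b * log (∑ b', P a b')) - (P a b * log (∑ a', P a' b)) - negMulLog (P a b)
        + P a b * log κ := by
    intro a b
    rcases (hP a b).eq_or_lt with h | h
    · simp [← h]
    have h1 : 0 < ∑ b', P a b' :=
      lt_of_lt_of_le h (Finset.single_le_sum (fun b _ => hP a b) (Finset.mem_univ b))
    have h2 : 0 < ∑ a', P a' b :=
      lt_of_lt_of_le h (Finset.single_le_sum (fun a _ => hP a b) (Finset.mem_univ a))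
    rw [log_div (mul_pos h hκ).ne' (mul_pos h1 h2).ne', log_mul h.ne' hκ.ne',
      log_mul h1.ne' h2.ne', negMulLog]
    ring
  simp only [infoSum, hterm, Finset.sum_add_distrib, Finset.sum_sub_distrib,
    Finset.sum_neg_distrib, ← Finset.sum_mul, entropy, Fintype.sum_prod_type, negMulLog, neg_mul]
  rw [Finset.sum_comm (f := fun a b => P a b * log (∑ a', P a' b))]
  simp only [← Finset.sum_mul]
  ring

end

/-- The law of the channel output when the input has law `p`. -/
def outLaw {X B : Type*} [Fintype X] (p : X → ℝ) (K : X → B → ℝ) (b : B) : ℝ :=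
  ∑ x, p x * K x b

lemma sum_mul_row {X B : Type*} [Fintype B] {K : X → B → ℝ} (hK : ∀ x, K x ∈ stdSimplex ℝ B) (p : X → ℝ) (x : X) :
    ∑ b, p x * K x b = p x := by
  rw [← Finset.mul_sum, (hK x).2, mul_one]

section

variable {U X B C : Type*} [Fintype U] [Fintype X] [Fintype B] [Fintype C]

lemma entropy_mul_channel {K : X → B → ℝ} (hK : ∀ x, K x ∈ stdSimplex ℝ B) (p : X → ℝ) :
    entropy (fun z : X × B => p z.1 * K z.1 z.2) = entropy p + ∑ x, p x * entropy (K x) := by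
  have h : ∀ x, ∑ b, negMulLog (p x * K x b) = negMulLog (p x) + p x * entropy (K x) := by
    intro x
    have := entropy_smul (p x) (K x)
    rwa [(hK x).2, mul_one, entropy] at this
  simp only [entropy, Fintype.sum_prod_type, h, Finset.sum_add_distrib]

lemma channelInfo_eq {p : X → ℝ} (hp : ∀ x, 0 ≤ p x) {K : X → B → ℝ}
    (hK : ∀ x, K x ∈ stdSimplex ℝ B) :
    channelInfo p K * log 2 = entropy (outLaw p K) - ∑ x, p x * entropy (K x) := by
  rw [channelInfo, mutualInfo_mul_log_two,
    infoSum_eq_entropy one_pos fun a b => mul_nonneg (hp a) ((hK a).1 b)]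
  have := entropy_mul_channel hK p
  simp only [log_one, mul_zero, add_zero, sum_mul_row hK, this]
  unfold outLaw
  ring

lemma auxInfo_eq {p : U × X → ℝ} (hp : ∀ z, 0 ≤ p z) {K : X → B → ℝ}
    (hK : ∀ x, K x ∈ stdSimplex ℝ B) :
    auxInfo p K * log 2 = entropy (fun u => ∑ x, p (u, x))
      + entropy (outLaw (fun x => ∑ u, p (u, x)) K)
      - entropy (fun z : U × B => ∑ x, p (z.1, x) * K x z.2) := by
  rw [auxInfo, mutualInfo_mul_log_two, infoSum_eq_entropy one_pos fun a b =>
    Finset.sum_nonneg fun x _ => mul_nonneg (hp _) ((hK x).1 b)]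
  have h1 : ∀ u, ∑ b, ∑ x, p (u, x) * K x b = ∑ x, p (u, x) := fun u => by
    rw [Finset.sum_comm]
    exact Finset.sum_congr rfl fun x _ => sum_mul_row hK (fun x => p (u, x)) x
  have h2 : (fun b => ∑ u, ∑ x, p (u, x) * K x b) = outLaw (fun x => ∑ u, p (u, x)) K := by
    funext b
    rw [Finset.sum_comm]
    exact Finset.sum_congr rfl fun x _ => by rw [Finset.sum_mul]
  simp only [h1, h2, log_one, mul_zero, add_zero]

lemma condInfo_eq {p : U × X → ℝ} (hp : ∀ z, 0 ≤ p z) {K : X → B → ℝ}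
    (hK : ∀ x, K x ∈ stdSimplex ℝ B) :
    condInfo p K * log 2 = entropy (fun z : U × B => ∑ x, p (z.1, x) * K x z.2)
      - entropy (fun u => ∑ x, p (u, x)) - ∑ x, (∑ u, p (u, x)) * entropy (K x) := by
  rw [condInfo, condMutualInfo_mul_log_two]
  have key : ∀ u, infoSum (∑ x, ∑ b, p (u, x) * K x b) (fun x b => p (u, x) * K x b) =
      ∑ b, negMulLog (∑ x, p (u, x) * K x b) - negMulLog (∑ x, p (u, x))
        - ∑ x, p (u, x) * entropy (K x) := by
    intro u
    have hs : ∑ x, ∑ b, p (u, x) * K x b = ∑ x, p (u, x) :=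
      Finset.sum_congr rfl fun x _ => sum_mul_row hK (fun x => p (u, x)) x
    rcases (Finset.sum_nonneg fun x (_ : x ∈ Finset.univ) => hp (u, x)).eq_or_lt with h | h
    · have hz : ∀ x, p (u, x) = 0 := fun x =>
        (Finset.sum_eq_zero_iff_of_nonneg fun x _ => hp (u, x)).1 h.symm x (Finset.mem_univ x)
      simp [infoSum, hz]
    · rw [hs, infoSum_eq_entropy h fun x b => mul_nonneg (hp _) ((hK x).1 b), hs,
        entropy_mul_channel hK (fun x => p (u, x))]
      simp only [fun x => sum_mul_row hK (fun x => p (u, x)) x, entropy, negMulLog]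
      ring
  simp only [key, Finset.sum_sub_distrib, Finset.sum_mul]
  rw [Finset.sum_comm (f := fun u x => p (u, x) * entropy (K x))]
  simp only [entropy, Fintype.sum_prod_type]

/-- Chain rule `I(U;B) + I(X;B|U) = I(X;B)` along the Markov chain `U - X - B`. -/
lemma auxInfo_add_condInfo {p : U × X → ℝ} (hp : ∀ z, 0 ≤ p z) {K : X → B → ℝ}
    (hK : ∀ x, K x ∈ stdSimplex ℝ B) :
    auxInfo p K + condInfo p K = channelInfo (fun x => ∑ u, p (u, x)) K := by
  have h2 : log 2 ≠ 0 := (log_pos one_lt_two).ne'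
  apply mul_right_cancel₀ h2
  rw [add_mul, auxInfo_eq hp hK, condInfo_eq hp hK,
    channelInfo_eq (fun x => Finset.sum_nonneg fun u _ => hp (u, x)) hK]
  ring

lemma condInfo_nonneg {p : U × X → ℝ} (hp : ∀ z, 0 ≤ p z) {K : X → B → ℝ}
    (hK : ∀ x, K x ∈ stdSimplex ℝ B) : 0 ≤ condInfo p K := by
  refine nonneg_of_mul_nonneg_left ?_ (log_pos one_lt_two)
  rw [condInfo, condMutualInfo_mul_log_two]
  exact Finset.sum_nonneg fun u _ => infoSum_nonneg fun x b => mul_nonneg (hp _) ((hK x).1 b)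

lemma mutualInfo_nonneg {P : U × B → ℝ} (hP : ∀ z, 0 ≤ P z) (h1 : ∑ z, P z = 1) :
    0 ≤ mutualInfo P := by
  refine nonneg_of_mul_nonneg_left ?_ (log_pos one_lt_two)
  rw [mutualInfo_mul_log_two, ← h1, Fintype.sum_prod_type]
  exact infoSum_nonneg fun u b => hP (u, b)

lemma sum_mul_channel_eq_one {p : X → ℝ} (hp : p ∈ stdSimplex ℝ X) {K : X → B → ℝ}
    (hK : ∀ x, K x ∈ stdSimplex ℝ B) : ∑ z : X × B, p z.1 * K z.1 z.2 = 1 := by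
  simp only [Fintype.sum_prod_type, sum_mul_row hK, hp.2]

lemma channelInfo_nonneg {p : X → ℝ} (hp : p ∈ stdSimplex ℝ X) {K : X → B → ℝ}
    (hK : ∀ x, K x ∈ stdSimplex ℝ B) : 0 ≤ channelInfo p K :=
  mutualInfo_nonneg (fun _ => mul_nonneg (hp.1 _) ((hK _).1 _)) (sum_mul_channel_eq_one hp hK)

lemma auxInfo_nonneg {p : U × X → ℝ} (hp : p ∈ stdSimplex ℝ (U × X)) {K : X → B → ℝ}
    (hK : ∀ x, K x ∈ stdSimplex ℝ B) : 0 ≤ auxInfo p K := by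
  refine mutualInfo_nonneg
    (fun _ => Finset.sum_nonneg fun x _ => mul_nonneg (hp.1 _) ((hK _).1 _)) ?_
  rw [Fintype.sum_prod_type, ← hp.2, Fintype.sum_prod_type]
  refine Finset.sum_congr rfl fun u _ => ?_
  rw [Finset.sum_comm]
  exact Finset.sum_congr rfl fun x _ => sum_mul_row hK (fun x => p (u, x)) x

/-- The channel `K` followed by the channel `V`. -/
def compChannel (K : X → B → ℝ) (V : B → C → ℝ) (x : X) (c : C) : ℝ := ∑ b, K x b * V b c

lemma auxInfo_comp_le {p : U × X → ℝ} (hp : ∀ z, 0 ≤ p z) {K : X → B → ℝ}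
    (hK : ∀ x, K x ∈ stdSimplex ℝ B) {V : B → C → ℝ} (hV : ∀ b, V b ∈ stdSimplex ℝ C) :
    auxInfo p (compChannel K V) ≤ auxInfo p K := by
  refine le_of_mul_le_mul_right ?_ (log_pos one_lt_two)
  simp only [auxInfo, mutualInfo_mul_log_two]
  refine le_trans (le_of_eq ?_) (infoSum_comp_le zero_le_one
    (fun u b => Finset.sum_nonneg fun x _ => mul_nonneg (hp (u, x)) ((hK x).1 b)) hV
    fun h => absurd h one_ne_zero)
  congr 1
  funext u c
  simp only [compChannel, Finset.mul_sum, Finset.sum_mul]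
  rw [Finset.sum_comm]
  simp only [mul_assoc]

lemma condInfo_comp_le {p : U × X → ℝ} (hp : ∀ z, 0 ≤ p z) {K : X → B → ℝ}
    (hK : ∀ x, K x ∈ stdSimplex ℝ B) {V : B → C → ℝ} (hV : ∀ b, V b ∈ stdSimplex ℝ C) :
    condInfo p (compChannel K V) ≤ condInfo p K := by
  refine le_of_mul_le_mul_right ?_ (log_pos one_lt_two)
  simp only [condInfo, condMutualInfo_mul_log_two]
  refine Finset.sum_le_sum fun u _ => ?_
  have hn : ∀ x b, 0 ≤ p (u, x) * K x b := fun x b => mul_nonneg (hp (u, x)) ((hK x).1 b)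
  have e : (fun x c => p (u, x) * compChannel K V x c) =
      fun x c => ∑ b, (p (u, x) * K x b) * V b c := by
    funext x c
    simp only [compChannel, Finset.mul_sum, mul_assoc]
  have e2 : ∑ x, ∑ c, p (u, x) * compChannel K V x c = ∑ x, ∑ b, p (u, x) * K x b := by
    refine Finset.sum_congr rfl fun x _ => ?_
    have := congrFun e x
    rw [this, Finset.sum_comm]
    exact Finset.sum_congr rfl fun b _ => sum_mul_row hV (fun b => p (u, x) * K x b) b
  rw [e2, e]
  refine infoSum_comp_le (Finset.sum_nonneg fun _ _ => Finset.sum_nonneg fun _ _ => hn _ _) hn hV ?_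
  intro h
  funext x b
  have h1 := (Finset.sum_eq_zero_iff_of_nonneg
    fun x _ => Finset.sum_nonneg fun b _ => hn x b).1 h x (Finset.mem_univ x)
  exact (Finset.sum_eq_zero_iff_of_nonneg fun b _ => hn x b).1 h1 b (Finset.mem_univ b)

lemma channelInfo_mul_log_two {p : X → ℝ} {K : X → B → ℝ} (hK : ∀ x, K x ∈ stdSimplex ℝ B) :
    channelInfo p K * log 2 = ∑ x, p x * ∑ b, K x b * log (K x b / outLaw p K b) := by
  rw [channelInfo, mutualInfo_mul_log_two, infoSum]
  refine Finset.sum_congr rfl fun x _ => ?_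
  rw [Finset.mul_sum]
  refine Finset.sum_congr rfl fun b _ => ?_
  rw [sum_mul_row hK, mul_one]
  rcases eq_or_ne (p x) 0 with h | h
  · simp [h]
  · rw [mul_div_mul_left _ _ h, mul_assoc]; rfl

/-- Appending to the output a further letter that depends on the input only through the output
does not change the information. -/
lemma channelInfo_eq_of_factor {p : X → ℝ} {K : X → B → ℝ} (hK : ∀ x, K x ∈ stdSimplex ℝ B)
    {V : B → C → ℝ} (hV : ∀ b, V b ∈ stdSimplex ℝ C) {D : Type*} [Fintype D]
    (e : D ≃ B × C) {J : X → D → ℝ} (hJ : ∀ x d, J x d = K x (e d).1 * V (e d).1 (e d).2) :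
    channelInfo p J = channelInfo p K := by
  have hsum : ∀ x (g : B × C → ℝ), ∑ d, J x d * g (e d) = ∑ b, ∑ c, K x b * V b c * g (b, c) := by
    intro x g
    rw [← Fintype.sum_prod_type', ← e.sum_comp]
    exact Finset.sum_congr rfl fun d _ => by rw [hJ]
  have hJs : ∀ x, J x ∈ stdSimplex ℝ D := by
    intro x
    refine ⟨fun d => by rw [hJ]; exact mul_nonneg ((hK x).1 _) ((hV _).1 _), ?_⟩
    have := hsum x fun _ => 1
    simp only [mul_one] at this
    rw [this, ← (hK x).2]
    exact Finset.sum_congr rfl fun b _ => sum_mul_row hV (K x) b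
  apply mul_right_cancel₀ (log_pos one_lt_two).ne'
  rw [channelInfo_mul_log_two hJs, channelInfo_mul_log_two hK]
  refine Finset.sum_congr rfl fun x _ => ?_
  congr 1
  have h1 : ∀ d, J x d * log (J x d / outLaw p J d) =
      J x d * log (K x (e d).1 / outLaw p K (e d).1) := by
    intro d
    rcases eq_or_ne (V (e d).1 (e d).2) 0 with h | h
    · simp [hJ, h]
    · congr 2
      have : outLaw p J d = outLaw p K (e d).1 * V (e d).1 (e d).2 := by
        simp only [outLaw, hJ, Finset.sum_mul, mul_assoc]
      rw [this, hJ, mul_div_mul_right _ _ h]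
  simp only [h1]
  rw [hsum x fun z => log (K x z.1 / outLaw p K z.1)]
  dsimp only
  refine Finset.sum_congr rfl fun b _ => ?_
  rw [← Finset.sum_mul, sum_mul_row hV (K x) b]

/-! ### Continuity, concavity in the input law, convexity in the channel -/

lemma continuousOn_channelInfo {T : Type*} [TopologicalSpace T] {s : Set T} {p : T → X → ℝ}
    {K : T → X → B → ℝ} (hp : ContinuousOn p s) (hK : ContinuousOn K s)
    (hp0 : ∀ t ∈ s, ∀ x, 0 ≤ p t x) (hK0 : ∀ t ∈ s, ∀ x, K t x ∈ stdSimplex ℝ B) :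
    ContinuousOn (fun t => channelInfo (p t) (K t)) s := by
  have h : ∀ t ∈ s, channelInfo (p t) (K t) =
      (entropy (outLaw (p t) (K t)) - ∑ x, p t x * entropy (K t x)) / log 2 := fun t ht => by
    rw [← channelInfo_eq (hp0 t ht) (hK0 t ht), mul_div_cancel_right₀ _ (log_pos one_lt_two).ne']
  refine ContinuousOn.congr ?_ h
  have hpx : ∀ x, ContinuousOn (fun t => p t x) s := fun x =>
    (continuous_apply x).comp_continuousOn hp
  have hKx : ∀ x, ContinuousOn (fun t => K t x) s := fun x =>
    (continuous_apply x).comp_continuousOn hK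
  have hKxb : ∀ x b, ContinuousOn (fun t => K t x b) s := fun x b =>
    (continuous_apply b).comp_continuousOn (hKx x)
  refine ContinuousOn.div_const (ContinuousOn.sub ?_ ?_) _
  · refine continuous_entropy.comp_continuousOn (continuousOn_pi.2 fun b => ?_)
    exact continuousOn_finsetSum _ fun x _ => (hpx x).mul (hKxb x b)
  · exact continuousOn_finsetSum _ fun x _ =>
      (hpx x).mul (continuous_entropy.comp_continuousOn (hKx x))

lemma concaveOn_channelInfo {K : X → B → ℝ} (hK : ∀ x, K x ∈ stdSimplex ℝ B) :
    ConcaveOn ℝ (stdSimplex ℝ X) fun p => channelInfo p K := by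
  refine ⟨convex_stdSimplex ℝ X, fun p hp q hq a b ha hb hab => ?_⟩
  have hm := convex_stdSimplex ℝ X hp hq ha hb hab
  refine le_of_mul_le_mul_right ?_ (log_pos one_lt_two)
  simp only [smul_eq_mul]
  rw [add_mul, mul_assoc, mul_assoc, channelInfo_eq hp.1 hK, channelInfo_eq hq.1 hK,
    channelInfo_eq hm.1 hK]
  have hlin : ∀ g : X → ℝ, ∑ x, (a • p + b • q) x * g x =
      a * ∑ x, p x * g x + b * ∑ x, q x * g x := by
    intro g
    simp only [Pi.add_apply, Pi.smul_apply, smul_eq_mul, add_mul, Finset.sum_add_distrib,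
      Finset.mul_sum, mul_assoc]
  rw [hlin]
  have hH : a * entropy (outLaw p K) + b * entropy (outLaw q K) ≤
      entropy (outLaw (a • p + b • q) K) := by
    simp only [entropy, Finset.mul_sum, ← Finset.sum_add_distrib]
    refine Finset.sum_le_sum fun y _ => ?_
    have hn : ∀ {p : X → ℝ}, p ∈ stdSimplex ℝ X → outLaw p K y ∈ Set.Ici (0 : ℝ) := fun hp =>
      Finset.sum_nonneg fun x _ => mul_nonneg (hp.1 x) ((hK x).1 y)
    have := concaveOn_negMulLog.2 (hn hp) (hn hq) ha hb hab
    simp only [smul_eq_mul] at this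
    have hout : outLaw (a • p + b • q) K y = a * outLaw p K y + b * outLaw q K y := hlin _
    rwa [hout]
  linarith

lemma log_sum_two_le {a b k l r s : ℝ} (ha : 0 ≤ a) (hb : 0 ≤ b) (hk : 0 ≤ k) (hl : 0 ≤ l)
    (hr : 0 ≤ r) (hs : 0 ≤ s) (hrk : r = 0 → k = 0) (hsl : s = 0 → l = 0) :
    (a * k + b * l) * log ((a * k + b * l) / (a * r + b * s)) ≤
      a * (k * log (k / r)) + b * (l * log (l / s)) := by
  have := log_sum_le Finset.univ ![a * k, b * l] ![a * r, b * s]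
    (by simp [Fin.forall_fin_two, mul_nonneg, *]) (by simp [Fin.forall_fin_two, mul_nonneg, *])
    (by
      simp only [Fin.forall_fin_two, Finset.mem_univ, forall_true_left, Matrix.cons_val_zero,
        Matrix.cons_val_one, mul_eq_zero]
      exact ⟨fun h => h.imp_right hrk, fun h => h.imp_right hsl⟩)
  simp only [Fin.sum_univ_two, Matrix.cons_val_zero, Matrix.cons_val_one] at this
  refine this.trans (le_of_eq ?_)
  congr 1
  · rcases eq_or_ne a 0 with h | h
    · simp [h]
    · rw [mul_div_mul_left _ _ h, mul_assoc]
  · rcases eq_or_ne b 0 with h | h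
    · simp [h]
    · rw [mul_div_mul_left _ _ h, mul_assoc]

lemma outLaw_nonneg {p : X → ℝ} (hp : ∀ x, 0 ≤ p x) {K : X → B → ℝ}
    (hK : ∀ x, K x ∈ stdSimplex ℝ B) (b : B) : 0 ≤ outLaw p K b :=
  Finset.sum_nonneg fun x _ => mul_nonneg (hp x) ((hK x).1 b)

lemma eq_zero_of_outLaw_eq_zero {p : X → ℝ} (hp : ∀ x, 0 ≤ p x) {K : X → B → ℝ}
    (hK : ∀ x, K x ∈ stdSimplex ℝ B) {x : X} (hx : p x ≠ 0) {b : B} (h : outLaw p K b = 0) :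
    K x b = 0 := by
  have := (Finset.sum_eq_zero_iff_of_nonneg
    fun x _ => mul_nonneg (hp x) ((hK x).1 b)).1 h x (Finset.mem_univ x)
  exact (mul_eq_zero.1 this).resolve_left hx

lemma sum_outLaw {p : X → ℝ} (hp : p ∈ stdSimplex ℝ X) {K : X → B → ℝ}
    (hK : ∀ x, K x ∈ stdSimplex ℝ B) : ∑ b, outLaw p K b = 1 := by
  simp only [outLaw]
  rw [Finset.sum_comm, ← hp.2]
  exact Finset.sum_congr rfl fun x _ => sum_mul_row hK p x

lemma channelInfo_convex {p : X → ℝ} (hp : ∀ x, 0 ≤ p x) {K L : X → B → ℝ}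
    (hK : ∀ x, K x ∈ stdSimplex ℝ B) (hL : ∀ x, L x ∈ stdSimplex ℝ B) {a b : ℝ} (ha : 0 ≤ a)
    (hb : 0 ≤ b) (hab : a + b = 1) :
    channelInfo p (a • K + b • L) ≤ a * channelInfo p K + b * channelInfo p L := by
  have hm : ∀ x, (a • K + b • L) x ∈ stdSimplex ℝ B := fun x =>
    convex_stdSimplex ℝ B (hK x) (hL x) ha hb hab
  refine le_of_mul_le_mul_right ?_ (log_pos one_lt_two)
  rw [add_mul, mul_assoc, mul_assoc, channelInfo_mul_log_two hK, channelInfo_mul_log_two hL,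
    channelInfo_mul_log_two hm]
  simp only [Finset.mul_sum, ← Finset.sum_add_distrib]
  refine Finset.sum_le_sum fun x _ => Finset.sum_le_sum fun y _ => ?_
  rcases eq_or_ne (p x) 0 with h | h
  · simp [h]
  have hout : outLaw p (a • K + b • L) y = a * outLaw p K y + b * outLaw p L y := by
    simp only [outLaw, Pi.add_apply, Pi.smul_apply, smul_eq_mul, Finset.mul_sum,
      ← Finset.sum_add_distrib]
    exact Finset.sum_congr rfl fun x _ => by ring
  have := mul_le_mul_of_nonneg_left (log_sum_two_le ha hb ((hK x).1 y) ((hL x).1 y)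
    (outLaw_nonneg hp hK y) (outLaw_nonneg hp hL y) (eq_zero_of_outLaw_eq_zero hp hK h)
    (eq_zero_of_outLaw_eq_zero hp hL h)) (hp x)
  rw [hout]
  refine le_trans this (le_of_eq ?_)
  ring

end

/-! ### Product weights -/

section

variable {ι α : Type*} [Fintype ι] [DecidableEq ι] [Fintype α]

lemma sum_prod_mul_prod (P g : ι → α → ℝ) :
    ∑ y : ι → α, (∏ i, P i (y i)) * ∏ i, g i (y i) = ∏ i, ∑ a, P i a * g i a := by
  rw [Fintype.prod_sum]
  exact Finset.sum_congr rfl fun y _ => Finset.prod_mul_distrib.symm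

lemma sum_prod_eq_one {P : ι → α → ℝ} (hP : ∀ i, ∑ a, P i a = 1) :
    ∑ y : ι → α, ∏ i, P i (y i) = 1 := by
  rw [← Fintype.prod_sum, Finset.prod_congr rfl fun i _ => hP i, Finset.prod_const_one]

lemma sum_prod_mul_apply {P : ι → α → ℝ} (hP : ∀ i, ∑ a, P i a = 1) (j : ι) (g : α → ℝ) :
    ∑ y : ι → α, (∏ i, P i (y i)) * g (y j) = ∑ a, P j a * g a := by
  have h := sum_prod_mul_prod P (fun i a => if i = j then g a else 1)
  simp only [Finset.prod_ite_eq', Finset.mem_univ, if_true] at h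
  rw [h, Finset.prod_eq_single j]
  · simp
  · intro i _ hij; simp [hij, hP]
  · simp

lemma sum_prod_mul_apply_mul_apply {P : ι → α → ℝ} (hP : ∀ i, ∑ a, P i a = 1) {j k : ι}
    (hjk : j ≠ k) (g h : α → ℝ) :
    ∑ y : ι → α, (∏ i, P i (y i)) * (g (y j) * h (y k)) =
      (∑ a, P j a * g a) * ∑ a, P k a * h a := by
  have H := sum_prod_mul_prod P
    (fun i a => (if i = j then g a else 1) * (if i = k then h a else 1))
  simp only [Finset.prod_mul_distrib, Finset.prod_ite_eq', Finset.mem_univ, if_true] at H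
  rw [H, Fintype.prod_eq_mul j k hjk]
  · simp [hjk, hjk.symm]
  · intro i hi; simp [hi.1, hi.2, hP]

end

/-- The memoryless extension of the channel `K` to blocks. -/
def blockProb {X B : Type*} {n : ℕ} (K : X → B → ℝ) (x : Fin n → X) (y : Fin n → B) : ℝ :=
  ∏ i, K (x i) (y i)

section

variable {X B : Type*} [Fintype X] [Fintype B] {n M : ℕ}

lemma blockProb_nonneg {X B : Type*} [Fintype B] {n : ℕ} {K : X → B → ℝ}
    (hK : ∀ x, K x ∈ stdSimplex ℝ B) (x : Fin n → X) (y : Fin n → B) : 0 ≤ blockProb K x y :=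
  Finset.prod_nonneg fun i _ => (hK (x i)).1 (y i)

lemma sum_blockProb {X B : Type*} [Fintype B] {n : ℕ} {K : X → B → ℝ}
    (hK : ∀ x, K x ∈ stdSimplex ℝ B) (x : Fin n → X) : ∑ y, blockProb K x y = 1 :=
  sum_prod_eq_one fun i => (hK (x i)).2

/-! ### Converse -/

/-- Additivity of divergence from an i.i.d. reference measure. -/
lemma sum_blockProb_mul_log {X B : Type*} [Fintype B] {n : ℕ} {K : X → B → ℝ}
    (hK : ∀ x, K x ∈ stdSimplex ℝ B) (x : Fin n → X)
    {r : B → ℝ} (hr : ∀ i b, r b = 0 → K (x i) b = 0) :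
    ∑ y, blockProb K x y * log (blockProb K x y / ∏ i, r (y i)) =
      ∑ i, ∑ b, K (x i) b * log (K (x i) b / r b) := by
  have h : ∀ y : Fin n → B, blockProb K x y * log (blockProb K x y / ∏ i, r (y i)) =
      ∑ i, (∏ i, K (x i) (y i)) * log (K (x i) (y i) / r (y i)) := by
    intro y
    rcases eq_or_ne (blockProb K x y) 0 with h0 | h0
    · have h0' : ∏ i, K (x i) (y i) = 0 := h0
      simp [h0, h0']
    · have h1 : ∀ i ∈ Finset.univ, K (x i) (y i) ≠ 0 := Finset.prod_ne_zero_iff.1 h0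
      rw [← Finset.mul_sum, blockProb, ← Finset.prod_div_distrib, log_prod]
      exact fun i hi => div_ne_zero (h1 i hi) fun hz => h1 i hi (hr i _ hz)
  simp only [h]
  rw [Finset.sum_comm]
  exact Finset.sum_congr rfl fun i _ =>
    sum_prod_mul_apply (P := fun i b => K (x i) b) (fun i => (hK (x i)).2) i
      (fun b => log (K (x i) b / r b))

open Classical in
/-- The composition of a codebook: the law of a uniformly chosen letter of a uniformly chosen
codeword. -/
noncomputable def codebookLaw (enc : Fin M → Fin n → X) (x : X) : ℝ :=
  (∑ m, ∑ i, if enc m i = x then 1 else 0) / (M * n)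

lemma sum_codebookLaw_mul (enc : Fin M → Fin n → X) (g : X → ℝ) :
    ∑ x, codebookLaw enc x * g x = (∑ m, ∑ i, g (enc m i)) / (M * n) := by
  classical
  simp only [codebookLaw, div_mul_eq_mul_div, ← Finset.sum_div, Finset.sum_mul]
  congr 1
  rw [Finset.sum_comm]
  refine Finset.sum_congr rfl fun m _ => ?_
  rw [Finset.sum_comm]
  exact Finset.sum_congr rfl fun i _ => by simp

lemma codebookLaw_mem (hM : 0 < M) (hn : 0 < n) (enc : Fin M → Fin n → X) :
    codebookLaw enc ∈ stdSimplex ℝ X := by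
  refine ⟨fun x => div_nonneg (Finset.sum_nonneg fun m _ => Finset.sum_nonneg fun i _ => by
    split_ifs <;> norm_num) (by positivity), ?_⟩
  have h := sum_codebookLaw_mul enc fun _ => 1
  simp only [mul_one] at h
  have h1 : (M : ℝ) * n ≠ 0 := by positivity
  rw [h]
  simp [h1]

lemma codebookLaw_apply_ne_zero {X : Type*} {n M : ℕ} (hM : 0 < M) (hn : 0 < n) (enc : Fin M → Fin n → X)
    (m : Fin M) (i : Fin n) : codebookLaw enc (enc m i) ≠ 0 := by
  refine (div_pos ?_ (by positivity)).ne'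
  refine Finset.sum_pos' (fun m _ => Finset.sum_nonneg fun i _ => by split_ifs <;> norm_num)
    ⟨m, Finset.mem_univ m, ?_⟩
  exact Finset.sum_pos' (fun i _ => by split_ifs <;> norm_num) ⟨i, Finset.mem_univ i, by simp⟩

/-- Weak converse for list decoding over a memoryless channel. The joint law of message and output
is compared with the product of the uniform law and `r ^ n`, where `r` is the output law belonging
to the composition of the codebook; a decoder with lists of size `L` succeeds with probability at
most `L / M` under the latter. Relaying at rate `C₁` produces such lists with `L = 2 ^ (n C₁)`. -/
lemma log_mul_success_le {K : X → B → ℝ} (hK : ∀ x, K x ∈ stdSimplex ℝ B) (hM : 0 < M)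
    (hn : 0 < n) {L : ℕ} (hL : 0 < L) (enc : Fin M → Fin n → X)
    (list : (Fin n → B) → Finset (Fin M)) (hlist : ∀ z, (list z).card ≤ L) :
    log (M / L) * (∑ m, ∑ z, if m ∈ list z then blockProb K (enc m) z else 0) ≤
      M * (1 + n * (channelInfo (codebookLaw enc) K * log 2)) := by
  set p := codebookLaw enc with hpdef
  have hp : p ∈ stdSimplex ℝ X := codebookLaw_mem hM hn enc
  set r := outLaw p K with hr
  have hr0 : ∀ b, 0 ≤ r b := outLaw_nonneg hp.1 hK
  have hrK : ∀ m i b, r b = 0 → K (enc m i) b = 0 := fun m i b h =>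
    eq_zero_of_outLaw_eq_zero hp.1 hK (codebookLaw_apply_ne_zero hM hn enc m i) h
  have hM' : (0 : ℝ) < M := by exact_mod_cast hM
  have hL' : (0 : ℝ) < L := by exact_mod_cast hL
  have ht : (0 : ℝ) < M / L := div_pos hM' hL'
  let u : Fin M → (Fin n → B) → ℝ := fun m z => blockProb K (enc m) z
  let t : Fin M → (Fin n → B) → ℝ := fun m z => if m ∈ list z then (M / L : ℝ) else 1
  have htpos : ∀ m z, 0 < t m z := fun m z => by
    simp only [t]; split_ifs <;> [exact ht; exact one_pos]
  -- the tangent-line inequality with reference weight `t * r ^ n`, of total mass at most `2 * M`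
  have hterm : ∀ m z, u m z - t m z * ∏ i, r (z i) ≤ u m z * log (u m z / ∏ i, r (z i)) -
      log (M / L) * (if m ∈ list z then u m z else 0) := by
    intro m z
    have hz : ∏ i, r (z i) = 0 → u m z = 0 := by
      intro h
      obtain ⟨i, hi, h0⟩ := Finset.prod_eq_zero_iff.1 h
      exact Finset.prod_eq_zero hi (hrK m i _ h0)
    have hrn : 0 ≤ ∏ i, r (z i) := Finset.prod_nonneg fun i _ => hr0 _
    have h1 := sub_le_mul_log_div (blockProb_nonneg hK (enc m) z)
      (mul_nonneg (htpos m z).le hrn)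
      (fun h => hz ((mul_eq_zero.1 h).resolve_left (htpos m z).ne'))
    refine h1.trans (le_of_eq ?_)
    change u m z * log (u m z / _) = _
    rcases eq_or_ne (u m z) 0 with h0 | h0
    · simp [h0]
    · rw [mul_comm (t m z), ← div_div, log_div (div_ne_zero h0 fun h => h0 (hz h)) (htpos m z).ne',
        mul_sub]
      congr 1
      simp only [t]
      split_ifs
      · ring
      · simp
  have hsum := Finset.sum_le_sum fun m (_ : m ∈ Finset.univ) =>
    Finset.sum_le_sum fun z (_ : z ∈ Finset.univ) => hterm m z
  simp only [Finset.sum_sub_distrib, ← Finset.mul_sum] at hsum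
  have hu1 : ∑ m, ∑ z, u m z = M := by
    simp only [u, sum_blockProb hK]; simp
  have hv : ∑ m, ∑ z, t m z * ∏ i, r (z i) ≤ 2 * M := by
    rw [Finset.sum_comm]
    simp only [← Finset.sum_mul]
    have h1 : ∀ z, ∑ m, t m z ≤ 2 * M := by
      intro z
      have : ∀ m, t m z ≤ (if m ∈ list z then (M / L : ℝ) else 0) + 1 := fun m => by
        simp only [t]; split_ifs <;> linarith
      refine (Finset.sum_le_sum fun m _ => this m).trans ?_
      rw [Finset.sum_add_distrib, Finset.sum_ite_mem]
      simp only [Finset.univ_inter, Finset.sum_const, nsmul_eq_mul, Finset.card_univ,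
        Fintype.card_fin, mul_one]
      have : ((list z).card : ℝ) * (M / L) ≤ L * (M / L) :=
        mul_le_mul_of_nonneg_right (by exact_mod_cast hlist z) ht.le
      rw [mul_div_cancel₀ _ hL'.ne'] at this
      linarith
    calc _ ≤ ∑ z : Fin n → B, 2 * (M : ℝ) * ∏ i, r (z i) := Finset.sum_le_sum fun z _ =>
          mul_le_mul_of_nonneg_right (h1 z) (Finset.prod_nonneg fun i _ => hr0 _)
      _ = 2 * M := by
          rw [← Finset.mul_sum, sum_prod_eq_one (P := fun _ => r) fun _ => sum_outLaw hp hK,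
            mul_one]
  have hdiv : ∑ m, ∑ z, u m z * log (u m z / ∏ i, r (z i)) =
      M * (n * (channelInfo p K * log 2)) := by
    have h1 : ∀ m, ∑ z, u m z * log (u m z / ∏ i, r (z i)) =
        ∑ i, ∑ b, K (enc m i) b * log (K (enc m i) b / r b) := fun m =>
      sum_blockProb_mul_log hK (enc m) (hrK m)
    rw [Finset.sum_congr rfl fun m _ => h1 m, channelInfo_mul_log_two hK,
      sum_codebookLaw_mul enc (fun x => ∑ b, K x b * log (K x b / r b))]
    have hn' : (n : ℝ) ≠ 0 := by positivity
    field_simp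
  rw [hu1, hdiv] at hsum
  linarith

end

section

variable {X S Y Y₁ : Type*} [Fintype S] [Fintype Y] [Fintype Y₁]

lemma avg_mem (W : Channel X S Y Y₁) {q : S → ℝ} (hq : q ∈ stdSimplex ℝ S) (x : X) :
    W.avg q x ∈ stdSimplex ℝ (Y × Y₁) := by
  refine ⟨fun z => Finset.sum_nonneg fun s _ => mul_nonneg (hq.1 s) ((W.mem_simplex x s).1 z), ?_⟩
  simp only [Channel.avg]
  rw [Finset.sum_comm, ← hq.2]
  exact Finset.sum_congr rfl fun s _ => sum_mul_row (W.mem_simplex x) q s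

lemma avgY_mem (W : Channel X S Y Y₁) {q : S → ℝ} (hq : q ∈ stdSimplex ℝ S) (x : X) :
    W.avgY q x ∈ stdSimplex ℝ Y := by
  refine ⟨fun y => Finset.sum_nonneg fun y₁ _ => (avg_mem W hq x).1 _, ?_⟩
  rw [← (avg_mem W hq x).2, Fintype.sum_prod_type]
  rfl

lemma avgY₁_mem (W : Channel X S Y Y₁) {q : S → ℝ} (hq : q ∈ stdSimplex ℝ S) (x : X) :
    W.avgY₁ q x ∈ stdSimplex ℝ Y₁ := by
  refine ⟨fun y => Finset.sum_nonneg fun y₁ _ => (avg_mem W hq x).1 _, ?_⟩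
  rw [← (avg_mem W hq x).2, Fintype.sum_prod_type_right]
  rfl

lemma sum_blockProb_pair (W : Channel X S Y Y₁) (q : S → ℝ) {n : ℕ} (x : Fin n → X)
    (y : Fin n → Y) :
    ∑ y₁ : Fin n → Y₁, blockProb (W.avg q) x (fun i => (y i, y₁ i)) =
      blockProb (W.avgY q) x y := by
  simp only [blockProb, Channel.avgY]
  rw [Fintype.prod_sum]

lemma sum_blockProb_pair' (W : Channel X S Y Y₁) (q : S → ℝ) {n : ℕ} (x : Fin n → X)
    (y₁ : Fin n → Y₁) :
    ∑ y : Fin n → Y, blockProb (W.avg q) x (fun i => (y i, y₁ i)) =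
      blockProb (W.avgY₁ q) x y₁ := by
  simp only [blockProb, Channel.avgY₁]
  rw [Fintype.prod_sum]

lemma sum_arrow_prod {n : ℕ} (f : (Fin n → Y × Y₁) → ℝ) :
    ∑ z, f z = ∑ y : Fin n → Y, ∑ y₁ : Fin n → Y₁, f (fun i => (y i, y₁ i)) := by
  rw [← Fintype.sum_prod_type' (f := fun (y : Fin n → Y) (y₁ : Fin n → Y₁) =>
    f (fun i => (y i, y₁ i))), ← (Equiv.arrowProdEquivProdArrow (Fin n) (fun _ => Y)
      (fun _ => Y₁)).sum_comp]
  rfl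

/-- Averaging an i.i.d. state sequence turns the state-dependent channel into the memoryless
extension of the averaged channel. -/
lemma error_eq (W : Channel X S Y Y₁) {n M L : ℕ} (c : Code X Y Y₁ n M L) (q : S → ℝ) :
    W.error c q = (1 / (M : ℝ)) * ∑ m : Fin M, ∑ y : Fin n → Y, ∑ y₁ : Fin n → Y₁,
      if c.dec y (c.relay y₁) ≠ m then
        blockProb (W.avg q) (c.enc m) (fun i => (y i, y₁ i)) else 0 := by
  have h : ∀ m (y : Fin n → Y) (y₁ : Fin n → Y₁),
      blockProb (W.avg q) (c.enc m) (fun i => (y i, y₁ i)) =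
        ∑ s : Fin n → S, (∏ i, q (s i)) * ∏ i, W.W (c.enc m i) (s i) (y i, y₁ i) := by
    intro m y y₁
    rw [sum_prod_mul_prod (fun _ => q) (fun i s => W.W (c.enc m i) s (y i, y₁ i))]
    rfl
  simp only [Channel.error, Channel.condError]
  simp only [mul_left_comm _ (1 / (M : ℝ)), ← Finset.mul_sum]
  congr 1
  simp only [Finset.mul_sum]
  rw [Finset.sum_comm]
  refine Finset.sum_congr rfl fun m _ => ?_
  rw [Finset.sum_comm]
  refine Finset.sum_congr rfl fun y _ => ?_
  rw [Finset.sum_comm]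
  refine Finset.sum_congr rfl fun y₁ _ => ?_
  split_ifs with hd
  · rw [h]
  · simp

lemma sum_success_eq (W : Channel X S Y Y₁) {n M L : ℕ} (hM : 0 < M) (c : Code X Y Y₁ n M L)
    {q : S → ℝ} (hq : q ∈ stdSimplex ℝ S) :
    ∑ m : Fin M, ∑ y : Fin n → Y, ∑ y₁ : Fin n → Y₁,
      (if c.dec y (c.relay y₁) = m then
        blockProb (W.avg q) (c.enc m) (fun i => (y i, y₁ i)) else 0) = M * (1 - W.error c q) := by
  have hM' : (M : ℝ) ≠ 0 := by positivity
  have h1 : ∑ m : Fin M, ∑ y : Fin n → Y, ∑ y₁ : Fin n → Y₁,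
      blockProb (W.avg q) (c.enc m) (fun i => (y i, y₁ i)) = M := by
    simp only [sum_blockProb_pair, sum_blockProb (avgY_mem W hq)]
    simp
  have h2 : (M : ℝ) * W.error c q = ∑ m : Fin M, ∑ y : Fin n → Y, ∑ y₁ : Fin n → Y₁,
      if c.dec y (c.relay y₁) ≠ m then
        blockProb (W.avg q) (c.enc m) (fun i => (y i, y₁ i)) else 0 := by
    rw [error_eq, ← mul_assoc, mul_one_div_cancel hM', one_mul]
  rw [mul_sub, mul_one, h2]
  nth_rewrite 1 [← h1]
  simp only [← Finset.sum_sub_distrib]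
  refine Finset.sum_congr rfl fun m _ => Finset.sum_congr rfl fun y _ =>
    Finset.sum_congr rfl fun y₁ _ => ?_
  split_ifs <;> simp_all

variable [Fintype X]

/-- The cutset bound for a single code, with the same input law in both cuts. -/
lemma exists_le_cutsetObjective (W : Channel X S Y Y₁) {q : S → ℝ} (hq : q ∈ stdSimplex ℝ S)
    {n M L : ℕ} (hn : 0 < n) (hL : 0 < L) {C₁ R ε : ℝ} (hR : 0 ≤ R) (hC₁ : 0 ≤ C₁)
    (hM : (2 : ℝ) ^ ((n : ℝ) * R) ≤ M) (hLC : (L : ℝ) ≤ (2 : ℝ) ^ ((n : ℝ) * C₁))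
    (c : Code X Y Y₁ n M L) (hε0 : 0 ≤ ε) (hε1 : ε ≤ 1) (hε : W.error c q ≤ ε) :
    ∃ p ∈ stdSimplex ℝ X, (1 - ε) * R ≤ W.cutsetObjective C₁ q p + 2 / n := by
  have hMr : (0 : ℝ) < M := lt_of_lt_of_le (by positivity) hM
  have hM0 : 0 < M := by exact_mod_cast hMr
  have hLr : (0 : ℝ) < L := by exact_mod_cast hL
  have hnr : (0 : ℝ) < n := by exact_mod_cast hn
  have hl2 : 0 < log 2 := log_pos one_lt_two
  have hl2' : 1 ≤ 2 * log 2 := by have := log_two_gt_d9; linarith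
  have hlogM : n * R * log 2 ≤ log M := by
    rw [← log_rpow two_pos]; exact log_le_log (by positivity) hM
  have hlogL : log L ≤ n * C₁ * log 2 := by
    rw [← log_rpow two_pos]; exact log_le_log hLr hLC
  have hp := codebookLaw_mem hM0 hn c.enc
  refine ⟨codebookLaw c.enc, hp, ?_⟩
  have finish : ∀ I : ℝ, (1 - ε) * (n * R * log 2) ≤ 1 + n * (I * log 2) →
      (1 - ε) * R ≤ I + 2 / n := by
    intro I h
    refine le_of_mul_le_mul_right ?_ (mul_pos hnr hl2)
    have : (I + 2 / n) * (n * log 2) = n * (I * log 2) + 2 * log 2 := by field_simp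
    rw [this]
    linarith
  rw [Channel.cutsetObjective, ← min_add_add_right]
  refine le_min ?_ ?_
  · -- the link adds at most a factor `L` to the list of messages compatible with `y`
    have h := log_mul_success_le (avgY_mem W hq) hM0 hn hL c.enc
      (fun y => Finset.univ.image (c.dec y)) fun y =>
        Finset.card_image_le.trans (by simp)
    rw [log_div hMr.ne' hLr.ne'] at h
    have hI := channelInfo_nonneg hp (avgY_mem W hq)
    refine finish _ ?_
    set I := channelInfo (codebookLaw c.enc) (W.avgY q)
    rcases le_total (log M) (log L) with hml | hml
    · have h1 : (1 - ε) * (n * R * log 2) ≤ 1 * (n * R * log 2) :=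
        mul_le_mul_of_nonneg_right (by linarith) (by positivity)
      have h2 : 0 ≤ n * (I * log 2) := by positivity
      nlinarith
    · have hs : (M : ℝ) * (1 - ε) ≤ ∑ m, ∑ y : Fin n → Y,
          if m ∈ Finset.univ.image (c.dec y) then blockProb (W.avgY q) (c.enc m) y else 0 := by
        refine le_trans (mul_le_mul_of_nonneg_left (by linarith) hMr.le)
          ((sum_success_eq W hM0 c hq).symm.le.trans ?_)
        refine Finset.sum_le_sum fun m _ => Finset.sum_le_sum fun y _ => ?_
        rw [← sum_blockProb_pair]
        split_ifs with hm
        · refine Finset.sum_le_sum fun y₁ _ => ?_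
          split_ifs
          · exact le_rfl
          · exact blockProb_nonneg (avg_mem W hq) _ _
        · refine (Finset.sum_eq_zero fun y₁ _ => if_neg fun h => hm ?_).le
          exact Finset.mem_image.2 ⟨_, Finset.mem_univ _, h⟩
      have h1 := (mul_le_mul_of_nonneg_left hs (sub_nonneg.2 hml)).trans h
      have h2 : (log M - log L) * (1 - ε) ≤ 1 + n * (I * log 2) := by
        refine le_of_mul_le_mul_left ?_ hMr
        linarith
      have h3 : (1 - ε) * (n * R * log 2 - n * C₁ * log 2) ≤ (1 - ε) * (log M - log L) :=
        mul_le_mul_of_nonneg_left (by linarith) (by linarith)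
      have h4 : 0 ≤ ε * (n * C₁ * log 2) := by positivity
      nlinarith
  · have h := log_mul_success_le (avg_mem W hq) hM0 hn one_pos c.enc
      (fun z => {c.dec (fun i => (z i).1) (c.relay fun i => (z i).2)}) fun y => by simp
    refine finish _ ?_
    simp only [sum_arrow_prod, Finset.mem_singleton, Nat.cast_one, div_one] at h
    have hs := sum_success_eq W hM0 c hq
    simp only [eq_comm (a := c.dec _ _)] at hs
    rw [hs] at h
    have h2 : log M * (1 - W.error c q) ≤
        1 + n * (channelInfo (codebookLaw c.enc) (W.avg q) * log 2) := by
      refine le_of_mul_le_mul_left ?_ hMr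
      linarith
    have hlM : 0 ≤ log M := le_trans (by positivity) hlogM
    have h3 : log M * (1 - ε) ≤ log M * (1 - W.error c q) :=
      mul_le_mul_of_nonneg_left (by linarith) hlM
    have h4 : (1 - ε) * (n * R * log 2) ≤ (1 - ε) * log M :=
      mul_le_mul_of_nonneg_left hlogM (by linarith)
    linarith

lemma Channel.Achievable.le_of_forall_cutsetObjective_le {W : Channel X S Y Y₁} {C₁ : ℝ}
    (hC₁ : 0 ≤ C₁) {Q : Set (S → ℝ)} {R : ℝ} (h : W.Achievable C₁ Q R) {q : S → ℝ} (hqQ : q ∈ Q)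
    (hq : q ∈ stdSimplex ℝ S) {v : ℝ} (hv : ∀ p ∈ stdSimplex ℝ X, W.cutsetObjective C₁ q p ≤ v) :
    R ≤ v := by
  obtain ⟨hR, hach⟩ := h
  by_contra! hlt
  set d := R - v with hd
  have hdpos : 0 < d := sub_pos.2 hlt
  set ε := min (1 / 2) (d / (4 * (R + 1))) with hεdef
  have hεpos : 0 < ε := lt_min (by norm_num) (by positivity)
  have hεR : ε * R ≤ d / 4 := by
    have h1 : ε * (R + 1) ≤ d / (4 * (R + 1)) * (R + 1) :=
      mul_le_mul_of_nonneg_right (min_le_right _ _) (by linarith)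
    have h2 : d / (4 * (R + 1)) * (R + 1) = d / 4 := by field_simp
    nlinarith
  obtain ⟨N, hN⟩ := hach ε hεpos
  obtain ⟨k, hk⟩ := exists_nat_gt (8 / d)
  set n := max N (k + 1) with hn
  have hn0 : 0 < n := lt_of_lt_of_le (Nat.succ_pos k) (le_max_right _ _)
  obtain ⟨c, hc⟩ := hN n (le_max_left _ _)
  have hnk : (k : ℝ) ≤ n := by exact_mod_cast (Nat.le_succ k).trans (le_max_right N (k + 1))
  have hnr : (0 : ℝ) < n := by exact_mod_cast hn0
  have h1C : (1 : ℝ) ≤ (2 : ℝ) ^ ((n : ℝ) * C₁) := one_le_rpow one_le_two (by positivity)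
  obtain ⟨p, hp, hle⟩ := exists_le_cutsetObjective W hq hn0
    (Nat.floor_pos.2 h1C) hR hC₁ (Nat.le_ceil _) (Nat.floor_le (by positivity)) c hεpos.le
    ((min_le_left _ _).trans (by norm_num)) (hc q hqQ)
  have h2n : 2 / (n : ℝ) ≤ d / 4 := by
    rw [div_le_iff₀ hnr]
    have : 8 < n * d := by
      rw [← div_lt_iff₀ hdpos]; exact hk.trans_le hnk
    linarith
  have := hv p hp
  nlinarith

end

/-! ### A universal bound on i.i.d. state laws -/

/-- A single weight on state sequences, of total mass polynomial in `n`, that dominates every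
i.i.d. law. It is the reciprocal of the size of the type class. It lets one codebook serve all
state laws at once: a bound that is exponentially small on average over codebooks
remains small after summing against this weight. -/
lemma exists_weight_dominating_iid (S : Type*) [Fintype S] (n : ℕ) :
    ∃ F : (Fin n → S) → ℝ, (∀ s, 0 ≤ F s) ∧ ∑ s, F s ≤ ((n : ℝ) + 1) ^ Fintype.card S ∧
      ∀ q ∈ stdSimplex ℝ S, ∀ s, ∏ i, q (s i) ≤ F s := by
  classical
  let τ : (Fin n → S) → (S → Fin (n + 1)) := fun s a =>
    ⟨(Finset.univ.filter fun i => s i = a).card,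
      Nat.lt_succ_of_le ((Finset.card_filter_le _ _).trans (by simp))⟩
  let N : (S → Fin (n + 1)) → ℝ := fun t => ((Finset.univ.filter fun s => τ s = t).card : ℝ)
  have hN : ∀ t, 0 ≤ N t := fun t => Nat.cast_nonneg _
  refine ⟨fun s => 1 / N (τ s), fun s => div_nonneg zero_le_one (hN _), ?_, ?_⟩
  · rw [← Finset.sum_fiberwise Finset.univ τ]
    refine (Finset.sum_le_sum (g := fun _ => (1 : ℝ)) fun t _ => ?_).trans (by simp)
    rw [Finset.sum_congr rfl fun s hs => by rw [(Finset.mem_filter.1 hs).2], Finset.sum_const,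
      nsmul_eq_mul, mul_one_div]
    exact div_self_le_one _
  · intro q hq s
    have hτ : ∀ s : Fin n → S, ∏ i, q (s i) = ∏ a, q a ^ (τ s a : ℕ) := by
      intro s
      rw [Finset.prod_comp]
      refine Finset.prod_subset (Finset.subset_univ _) fun a _ ha => ?_
      rw [Finset.card_eq_zero.2, pow_zero]
      rw [Finset.filter_eq_empty_iff]
      exact fun i _ h => ha (h ▸ Finset.mem_image_of_mem s (Finset.mem_univ i))
    have hpos : 0 < N (τ s) := by
      simp only [N, Nat.cast_pos, Finset.card_pos]
      exact ⟨s, by simp⟩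
    rw [le_div_iff₀ hpos, mul_comm]
    calc N (τ s) * ∏ i, q (s i)
        = ∑ s' ∈ Finset.univ.filter fun s' => τ s' = τ s, ∏ i, q (s' i) := by
          rw [Finset.sum_congr rfl fun s' hs' => by
            rw [hτ s', (Finset.mem_filter.1 hs').2, ← hτ s], Finset.sum_const, nsmul_eq_mul]
      _ ≤ ∑ s' : Fin n → S, ∏ i, q (s' i) :=
          Finset.sum_le_sum_of_subset_of_nonneg (Finset.filter_subset _ _)
            fun s' _ _ => Finset.prod_nonneg fun i _ => hq.1 _
      _ = 1 := sum_prod_eq_one fun _ => hq.2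

/-! ### Large deviations -/

/-- Chernoff's bound for sums of independent variables with values in `[-B, B]`, with a free
parameter `l`; it rests on `exp t ≤ 1 + t + t²` for `|t| ≤ 1`. -/
lemma chernoff {A : Type*} [Fintype A] {n : ℕ} {P f : Fin n → A → ℝ}
    (hP : ∀ i, P i ∈ stdSimplex ℝ A) {B l η c : ℝ} (hf : ∀ i a, |f i a| ≤ B) (hl : 0 ≤ l)
    (hlB : l * B ≤ 1) (hlη : l * B ^ 2 ≤ η / 2)
    (hc : c ≤ (∑ i, ∑ a, P i a * f i a) - n * η) :
    (∑ y : Fin n → A, (∏ i, P i (y i)) * (if ∑ i, f i (y i) ≤ c then 1 else 0)) ≤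
      exp (-(l * η / 2) * n) := by
  have hmom : ∀ i, ∑ a, P i a * exp (-(l * f i a)) ≤
      exp (-(l * ∑ a, P i a * f i a) + l ^ 2 * B ^ 2) := by
    intro i
    have h1 : ∀ a, exp (-(l * f i a)) ≤ 1 - l * f i a + l ^ 2 * B ^ 2 := by
      intro a
      have hle : |-(l * f i a)| ≤ 1 := by
        rw [abs_neg, abs_mul, abs_of_nonneg hl]
        exact (mul_le_mul_of_nonneg_left (hf i a) hl).trans hlB
      have h2 := (abs_le.1 (abs_exp_sub_one_sub_id_le hle)).2
      have h3 : f i a ^ 2 ≤ B ^ 2 := sq_le_sq' (neg_le_of_abs_le (hf i a)) (le_of_abs_le (hf i a))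
      have h4 := mul_le_mul_of_nonneg_left h3 (sq_nonneg l)
      nlinarith
    have h5 : ∑ a, P i a * exp (-(l * f i a)) ≤
        ∑ a, (P i a - l * (P i a * f i a) + P i a * (l ^ 2 * B ^ 2)) :=
      Finset.sum_le_sum fun a _ =>
        (mul_le_mul_of_nonneg_left (h1 a) ((hP i).1 a)).trans (le_of_eq (by ring))
    rw [Finset.sum_add_distrib, Finset.sum_sub_distrib, ← Finset.sum_mul, (hP i).2,
      ← Finset.mul_sum] at h5
    have h6 := add_one_le_exp (-(l * ∑ a, P i a * f i a) + l ^ 2 * B ^ 2)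
    linarith
  calc (∑ y : Fin n → A, (∏ i, P i (y i)) * (if ∑ i, f i (y i) ≤ c then 1 else 0))
      ≤ ∑ y : Fin n → A, exp (l * c) * ((∏ i, P i (y i)) * ∏ i, exp (-(l * f i (y i)))) := by
        refine Finset.sum_le_sum fun y _ => ?_
        have hPn : 0 ≤ ∏ i, P i (y i) := Finset.prod_nonneg fun i _ => (hP i).1 _
        rw [mul_left_comm, ← exp_sum, ← exp_add]
        refine mul_le_mul_of_nonneg_left ?_ hPn
        rw [Finset.sum_neg_distrib, ← Finset.mul_sum]
        split_ifs with h
        · rw [one_le_exp_iff]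
          nlinarith
        · exact (exp_pos _).le
    _ = exp (l * c) * ∏ i, ∑ a, P i a * exp (-(l * f i a)) := by
        rw [← Finset.mul_sum, sum_prod_mul_prod P fun i a => exp (-(l * f i a))]
    _ ≤ exp (l * c) * ∏ i, exp (-(l * ∑ a, P i a * f i a) + l ^ 2 * B ^ 2) := by
        refine mul_le_mul_of_nonneg_left (Finset.prod_le_prod (fun i _ => ?_) fun i _ => hmom i)
          (exp_pos _).le
        exact Finset.sum_nonneg fun a _ => mul_nonneg ((hP i).1 a) (exp_pos _).le
    _ = exp (l * c + (-(l * ∑ i, ∑ a, P i a * f i a) + n * (l ^ 2 * B ^ 2))) := by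
        rw [← exp_sum, ← exp_add, Finset.sum_add_distrib, Finset.sum_neg_distrib,
          ← Finset.mul_sum]
        simp
    _ ≤ exp (-(l * η / 2) * n) := by
        refine exp_le_exp.2 ?_
        have h1 := mul_le_mul_of_nonneg_left hc hl
        have h2 := mul_le_mul_of_nonneg_left hlη (mul_nonneg hl (Nat.cast_nonneg (α := ℝ) n))
        nlinarith

lemma exists_forall_pow_mul_exp_le (k : ℕ) (A : ℝ) {γ ε : ℝ} (hγ : 0 < γ) (hε : 0 < ε) :
    ∃ N : ℕ, ∀ n : ℕ, N ≤ n → ((n : ℝ) + 1) ^ k * (A * exp (-γ * n)) ≤ ε := by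
  have h1 : |exp (-γ)| < 1 := by
    rw [abs_of_pos (exp_pos _), exp_lt_one_iff]; linarith
  have h2 := ((tendsto_pow_const_mul_const_pow_of_abs_lt_one k h1).comp
    (Filter.tendsto_add_atTop_nat 1)).const_mul (A * exp γ)
  rw [mul_zero] at h2
  obtain ⟨N, hN⟩ := Filter.eventually_atTop.1 (h2.eventually_le_const hε)
  refine ⟨N, fun n hn => (le_of_eq ?_).trans (hN n hn)⟩
  have : exp (-γ * n) = exp γ * exp (-γ) ^ (n + 1) := by
    rw [← exp_nat_mul, ← exp_add]; congr 1; push_cast; ring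
  simp only [Function.comp, this]
  push_cast
  ring

/-! ### Decoding metrics -/

section

variable {X S B : Type*} [Fintype X] [Fintype S] [Fintype B]

/-- A real-valued substitute `φ` for the information density `log (K / r)`, which is `-∞` where `K`
vanishes. The first property bounds the probability that an independent codeword scores high. -/
lemma exists_metric {p : X → ℝ} (hp : p ∈ stdSimplex ℝ X) {K : X → B → ℝ}
    (hK : ∀ x, K x ∈ stdSimplex ℝ B) {T : ℝ} (hT : T < channelInfo p K * log 2) :
    ∃ φ : X → B → ℝ, (∀ b, ∑ x, p x * exp (φ x b) ≤ 1) ∧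
      T < ∑ x, p x * ∑ b, K x b * φ x b := by
  -- adding `η` inside the logarithm keeps it finite; dividing by `1 + η` restores the normalization
  set η := (channelInfo p K * log 2 - T) / 2 with hη
  have hηpos : 0 < η := by rw [hη]; linarith
  have hr := outLaw_nonneg hp.1 hK
  have hq : ∀ x b, 0 ≤ K x b / outLaw p K b := fun x b => div_nonneg ((hK x).1 b) (hr b)
  have hlog : log (1 + η) ≤ η := by
    have := log_le_sub_one_of_pos (show 0 < 1 + η by linarith); linarith
  refine ⟨fun x b => log ((K x b / outLaw p K b + η) / (1 + η)), fun b => ?_, ?_⟩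
  · have h1 : ∀ x, p x * exp (log ((K x b / outLaw p K b + η) / (1 + η))) =
        (p x * K x b / outLaw p K b + p x * η) / (1 + η) := by
      intro x
      rw [exp_log (div_pos (by linarith [hq x b]) (by linarith))]
      ring
    simp only [h1]
    rw [← Finset.sum_div, div_le_one (by linarith), Finset.sum_add_distrib, ← Finset.sum_div,
      ← Finset.sum_mul, hp.2, one_mul]
    have : (∑ x, p x * K x b) / outLaw p K b ≤ 1 := div_self_le_one (outLaw p K b)
    linarith
  · have h1 : channelInfo p K * log 2 - η ≤
        ∑ x, p x * ∑ b, K x b * log ((K x b / outLaw p K b + η) / (1 + η)) := by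
      have h2 : η = ∑ x, p x * ∑ b, K x b * η := by
        simp only [← Finset.sum_mul, (hK _).2, one_mul, hp.2]
      rw [channelInfo_mul_log_two hK]
      nth_rewrite 1 [h2]
      simp only [← Finset.sum_sub_distrib, Finset.mul_sum]
      refine Finset.sum_le_sum fun x _ => Finset.sum_le_sum fun b _ => ?_
      rw [← mul_sub, ← mul_sub, ← mul_assoc, ← mul_assoc]
      have hpK := mul_nonneg (hp.1 x) ((hK x).1 b)
      rcases hpK.eq_or_lt with h0 | h0
      · rw [← h0, zero_mul, zero_mul]
      refine mul_le_mul_of_nonneg_left ?_ hpK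
      have hK0 : 0 < K x b := lt_of_le_of_ne ((hK x).1 b) fun h => h0.ne' (by rw [← h, mul_zero])
      have hp0 : p x ≠ 0 := fun h => h0.ne' (by rw [h, zero_mul])
      have hr0 : 0 < outLaw p K b := lt_of_le_of_ne (hr b) fun h =>
        hK0.ne' (eq_zero_of_outLaw_eq_zero hp.1 hK hp0 h.symm)
      have hq0 := div_pos hK0 hr0
      rw [log_div (x := K x b / outLaw p K b + η) (by linarith) (by linarith)]
      have := log_le_log hq0 (show K x b / outLaw p K b ≤ K x b / outLaw p K b + η by linarith)
      linarith
    linarith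

/-- The channel obtained from a state-dependent one when the state has law `q`. -/
def mixChannel (K : X → S → B → ℝ) (q : S → ℝ) (x : X) (b : B) : ℝ := ∑ s, q s * K x s b

lemma mixChannel_mem {X S B : Type*} [Fintype S] [Fintype B] {K : X → S → B → ℝ}
    (hK : ∀ x s, K x s ∈ stdSimplex ℝ B) {q : S → ℝ}
    (hq : q ∈ stdSimplex ℝ S) (x : X) : mixChannel K q x ∈ stdSimplex ℝ B := by
  refine ⟨fun b => Finset.sum_nonneg fun s _ => mul_nonneg (hq.1 s) ((hK x s).1 b), ?_⟩
  simp only [mixChannel]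
  rw [Finset.sum_comm, ← hq.2]
  exact Finset.sum_congr rfl fun s _ => sum_mul_row (hK x) q s

lemma continuous_mixChannel {X S B : Type*} [Fintype S] (K : X → S → B → ℝ) :
    Continuous (mixChannel K) := by
  unfold mixChannel
  fun_prop

/-- Finitely many metrics serve a compact set of state laws: the expectation of a metric is
continuous in the state law. -/
lemma exists_finset_metric {p : X → ℝ} (hp : p ∈ stdSimplex ℝ X) {K : X → S → B → ℝ}
    (hK : ∀ x s, K x s ∈ stdSimplex ℝ B) {Q : Set (S → ℝ)} (hQ : Q ⊆ stdSimplex ℝ S)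
    (hQc : IsCompact Q) (hQne : Q.Nonempty) {T : ℝ}
    (hT : ∀ q ∈ Q, T < channelInfo p (mixChannel K q) * log 2) :
    ∃ (J : Finset (X → B → ℝ)) (δ : ℝ), 0 < δ ∧
      (∀ φ ∈ J, ∀ b, ∑ x, p x * exp (φ x b) ≤ 1) ∧
      ∀ q ∈ Q, ∃ φ ∈ J, T + δ ≤ ∑ x, p x * ∑ b, mixChannel K q x b * φ x b := by
  classical
  have hcont : ContinuousOn (fun q => channelInfo p (mixChannel K q)) Q :=
    continuousOn_channelInfo continuousOn_const (continuous_mixChannel K).continuousOn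
      (fun _ _ => hp.1) fun q hq => mixChannel_mem hK (hQ hq)
  obtain ⟨q₀, hq₀, hmin⟩ := hQc.exists_isMinOn hQne hcont
  obtain ⟨T', hT1, hT2⟩ := exists_between (hT q₀ hq₀)
  have hT' : ∀ q : Q, T' < channelInfo p (mixChannel K q.1) * log 2 := fun q =>
    hT2.trans_le (mul_le_mul_of_nonneg_right (hmin q.2) (log_pos one_lt_two).le)
  choose φ hφ1 hφ2 using fun q : Q => exists_metric hp (mixChannel_mem hK (hQ q.2)) (hT' q)
  have hlin : ∀ ψ : X → B → ℝ, Continuous fun q => ∑ x, p x * ∑ b, mixChannel K q x b * ψ x b := by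
    intro ψ
    have h := continuous_mixChannel K
    refine continuous_finsetSum _ fun x _ => continuous_const.mul
      (continuous_finsetSum _ fun b _ => Continuous.mul ?_ continuous_const)
    exact (continuous_apply b).comp ((continuous_apply x).comp h)
  obtain ⟨t, ht⟩ := hQc.elim_finite_subcover
    (fun q : Q => {q' | T' < ∑ x, p x * ∑ b, mixChannel K q' x b * φ q x b})
    (fun q => isOpen_lt continuous_const (hlin _))
    fun q hq => Set.mem_iUnion.2 ⟨⟨q, hq⟩, hφ2 ⟨q, hq⟩⟩
  refine ⟨t.image φ, T' - T, sub_pos.2 hT1, ?_, ?_⟩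
  · intro ψ hψ
    obtain ⟨q, -, rfl⟩ := Finset.mem_image.1 hψ
    exact hφ1 q
  · intro q hq
    obtain ⟨q', hq', hlt⟩ := Set.mem_iUnion₂.1 (ht hq)
    exact ⟨φ q', Finset.mem_image_of_mem _ hq', by
      have : T' < _ := hlt
      linarith⟩

open Classical in
/-- A threshold test `pass` for the compound channel. Codewords in `good`, which has nearly full
probability, pass against their own output whatever the state law; and against any fixed output, an
independent codeword passes with probability at most `c e^{-nT}`. -/
lemma exists_test {p : X → ℝ} (hp : p ∈ stdSimplex ℝ X) {K : X → S → B → ℝ}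
    (hK : ∀ x s, K x s ∈ stdSimplex ℝ B) {Q : Set (S → ℝ)} (hQ : Q ⊆ stdSimplex ℝ S)
    (hQc : IsCompact Q) (hQne : Q.Nonempty) {T : ℝ}
    (hT : ∀ q ∈ Q, T < channelInfo p (mixChannel K q) * log 2) :
    ∃ c : ℝ, 0 ≤ c ∧ ∀ ε : ℝ, 0 < ε → ∃ N : ℕ, ∀ n : ℕ, N ≤ n →
      ∃ (pass : (Fin n → X) → (Fin n → B) → Prop) (good : (Fin n → X) → Prop),
        (∑ x : Fin n → X, (∏ i, p (x i)) * (if good x then 0 else 1)) ≤ ε ∧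
        (∀ x, good x → ∀ q ∈ Q,
          ∑ y, blockProb (mixChannel K q) x y * (if pass x y then 0 else 1) ≤ ε) ∧
        ∀ y, ∑ x : Fin n → X, (∏ i, p (x i)) * (if pass x y then 1 else 0) ≤
          c * exp (-(T * n)) := by
  obtain ⟨J, δ, hδ, hJ1, hJ2⟩ := exists_finset_metric hp hK hQ hQc hQne hT
  obtain ⟨B₀, hB1, hB⟩ : ∃ B₀ : ℝ, 1 ≤ B₀ ∧ ∀ φ ∈ J, ∀ x b, |φ x b| ≤ B₀ := by
    have hnn : ∀ φ : X → B → ℝ, 0 ≤ ∑ x, ∑ b, |φ x b| := fun φ =>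
      Finset.sum_nonneg fun _ _ => Finset.sum_nonneg fun _ _ => abs_nonneg _
    refine ⟨1 + ∑ φ ∈ J, ∑ x, ∑ b, |φ x b|,
      le_add_of_nonneg_right (Finset.sum_nonneg fun φ _ => hnn φ), fun φ hφ x b => ?_⟩
    have h1 : |φ x b| ≤ ∑ b, |φ x b| :=
      Finset.single_le_sum (f := fun b => |φ x b|) (fun b _ => abs_nonneg _) (Finset.mem_univ b)
    have h2 : ∑ b, |φ x b| ≤ ∑ x, ∑ b, |φ x b| :=
      Finset.single_le_sum (f := fun x => ∑ b, |φ x b|)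
        (fun x _ => Finset.sum_nonneg fun _ _ => abs_nonneg _) (Finset.mem_univ x)
    have h3 := Finset.single_le_sum (f := fun φ : X → B → ℝ => ∑ x, ∑ b, |φ x b|)
      (fun φ _ => hnn φ) hφ
    linarith
  have hB0 : 0 < B₀ := by linarith
  -- the Chernoff parameter, chosen so that `l B₀ ≤ 1` and `l B₀² ≤ δ / 4`
  set l := min 1 (δ / 4) / B₀ ^ 2 with hl
  have hmpos : 0 < min 1 (δ / 4) := lt_min one_pos (by linarith)
  have hlpos : 0 < l := by positivity
  have hlB2 : l * B₀ ^ 2 = min 1 (δ / 4) := by rw [hl]; field_simp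
  have hlη : l * B₀ ^ 2 ≤ δ / 2 / 2 := by rw [hlB2]; exact (min_le_right _ _).trans (by linarith)
  have hlB : l * B₀ ≤ 1 := by
    have h1 : l * B₀ ≤ l * B₀ ^ 2 := mul_le_mul_of_nonneg_left (by nlinarith) hlpos.le
    exact h1.trans (hlB2.le.trans (min_le_left _ _))
  -- the mean of the metric `φ` given the input letter and the state
  let h : (X → B → ℝ) → S → X → ℝ := fun φ s x => ∑ b, K x s b * φ x b
  have hh : ∀ φ ∈ J, ∀ s x, |h φ s x| ≤ B₀ := by
    intro φ hφ s x
    refine (Finset.abs_sum_le_sum_abs _ _).trans ?_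
    rw [← one_mul B₀, ← (hK x s).2, Finset.sum_mul]
    refine Finset.sum_le_sum fun b _ => ?_
    rw [abs_mul, abs_of_nonneg ((hK x s).1 b)]
    exact mul_le_mul_of_nonneg_left (hB φ hφ x b) ((hK x s).1 b)
  have hmix : ∀ (φ : X → B → ℝ) (q : S → ℝ) (x : X),
      ∑ b, mixChannel K q x b * φ x b = ∑ s, q s * h φ s x := by
    intro φ q x
    simp only [mixChannel, h, Finset.sum_mul, Finset.mul_sum, mul_assoc]
    exact Finset.sum_comm
  set γ := l * (δ / 2) / 2 with hγ
  have hγpos : 0 < γ := by positivity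
  refine ⟨J.card, Nat.cast_nonneg _, fun ε hε => ?_⟩
  obtain ⟨N, hN⟩ := exists_forall_pow_mul_exp_le 0 (J.card * Fintype.card S + 1) hγpos hε
  refine ⟨N, fun n hn => ⟨fun x y => ∃ φ ∈ J, T * n < ∑ i, φ (x i) (y i),
    fun x => ∀ φ ∈ J, ∀ s, n * ((∑ a, p a * h φ s a) - δ / 2) < ∑ i, h φ s (x i), ?_, ?_, ?_⟩⟩
  · have hN' := hN n hn
    rw [pow_zero, one_mul] at hN'
    refine le_trans ?_ hN'
    calc _ ≤ ∑ x : Fin n → X, ∑ φ ∈ J, ∑ s, (∏ i, p (x i)) *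
          (if ∑ i, h φ s (x i) ≤ n * ((∑ a, p a * h φ s a) - δ / 2) then 1 else 0) := by
          refine Finset.sum_le_sum fun x _ => ?_
          simp only [← Finset.mul_sum]
          refine mul_le_mul_of_nonneg_left ?_ (Finset.prod_nonneg fun i _ => hp.1 _)
          have hnn : ∀ φ s, (0 : ℝ) ≤
              if ∑ i, h φ s (x i) ≤ n * ((∑ a, p a * h φ s a) - δ / 2) then 1 else 0 :=
            fun φ s => by split_ifs <;> norm_num
          split_ifs with hg
          · exact Finset.sum_nonneg fun φ _ => Finset.sum_nonneg fun s _ => hnn φ s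
          · push Not at hg
            obtain ⟨φ, hφ, s, hs⟩ := hg
            refine le_trans ?_ (Finset.single_le_sum (f := fun φ => ∑ s, if ∑ i, h φ s (x i) ≤
              n * ((∑ a, p a * h φ s a) - δ / 2) then (1 : ℝ) else 0)
              (fun φ _ => Finset.sum_nonneg fun s _ => hnn φ s) hφ)
            refine le_trans ?_ (Finset.single_le_sum (fun s _ => hnn φ s) (Finset.mem_univ s))
            rw [if_pos hs]
      _ = ∑ φ ∈ J, ∑ s, ∑ x : Fin n → X, (∏ i, p (x i)) *
          (if ∑ i, h φ s (x i) ≤ n * ((∑ a, p a * h φ s a) - δ / 2) then 1 else 0) := by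
          rw [Finset.sum_comm]
          exact Finset.sum_congr rfl fun φ _ => Finset.sum_comm
      _ ≤ ∑ φ ∈ J, ∑ _s : S, exp (-γ * n) := by
          refine Finset.sum_le_sum fun φ hφ => Finset.sum_le_sum fun s _ => ?_
          refine chernoff (P := fun _ => p) (f := fun _ => h φ s) (fun _ => hp)
            (fun _ a => hh φ hφ s a) hlpos.le hlB hlη ?_
          simp only [Finset.sum_const, Finset.card_univ, Fintype.card_fin, nsmul_eq_mul]
          linarith
      _ ≤ (J.card * Fintype.card S + 1) * exp (-γ * n) := by
          simp only [Finset.sum_const, Finset.card_univ, nsmul_eq_mul]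
          have := exp_pos (-γ * n)
          nlinarith
  · intro x hx q hq
    obtain ⟨φ, hφ, hle⟩ := hJ2 q hq
    have hqs := hQ hq
    have hmean : n * (T + δ / 2) ≤ ∑ i, ∑ b, mixChannel K q (x i) b * φ (x i) b := by
      simp only [hmix] at hle ⊢
      rw [Finset.sum_comm]
      have e1 : ∑ x, p x * ∑ s, q s * h φ s x = ∑ s, q s * ∑ x, p x * h φ s x := by
        simp only [Finset.mul_sum]
        rw [Finset.sum_comm]
        exact Finset.sum_congr rfl fun s _ => Finset.sum_congr rfl fun x _ => by ring
      rw [e1] at hle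
      have h1 : ∑ s, q s * (n * ((∑ a, p a * h φ s a) - δ / 2)) ≤ ∑ s, ∑ i, q s * h φ s (x i) := by
        refine Finset.sum_le_sum fun s _ => ?_
        rw [← Finset.mul_sum]
        exact mul_le_mul_of_nonneg_left (hx φ hφ s).le (hqs.1 s)
      refine le_trans ?_ h1
      have e2 : ∑ s, q s * (n * ((∑ a, p a * h φ s a) - δ / 2)) =
          n * ((∑ s, q s * ∑ a, p a * h φ s a) - (∑ s, q s) * (δ / 2)) := by
        rw [Finset.sum_mul, ← Finset.sum_sub_distrib, Finset.mul_sum]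
        exact Finset.sum_congr rfl fun s _ => by ring
      rw [e2, hqs.2]
      exact mul_le_mul_of_nonneg_left (by linarith) (Nat.cast_nonneg n)
    have hN' := hN n hn
    rw [pow_zero, one_mul] at hN'
    refine le_trans ?_ hN'
    calc _ ≤ ∑ y : Fin n → B, (∏ i, mixChannel K q (x i) (y i)) *
          (if ∑ i, φ (x i) (y i) ≤ T * n then 1 else 0) := by
          refine Finset.sum_le_sum fun y _ => mul_le_mul_of_nonneg_left ?_
            (blockProb_nonneg (mixChannel_mem hK hqs) x y)
          split_ifs with h1 h2 h2
          · exact zero_le_one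
          · exact le_rfl
          · exact le_rfl
          · exact absurd ⟨φ, hφ, not_le.1 h2⟩ h1
      _ ≤ exp (-γ * n) := by
          refine chernoff (P := fun i => mixChannel K q (x i)) (f := fun i => φ (x i))
            (fun i => mixChannel_mem hK hqs (x i)) (fun i b => hB φ hφ (x i) b) hlpos.le hlB hlη ?_
          linarith
      _ ≤ _ := by
          have := exp_pos (-γ * n)
          have h0 : (0 : ℝ) ≤ J.card * Fintype.card S := by positivity
          nlinarith
  · intro y
    calc _ ≤ ∑ x : Fin n → X, ∑ φ ∈ J, exp (-(T * n)) *
          ((∏ i, p (x i)) * ∏ i, exp (φ (x i) (y i))) := by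
          refine Finset.sum_le_sum fun x _ => ?_
          have hpn : 0 ≤ ∏ i, p (x i) := Finset.prod_nonneg fun i _ => hp.1 _
          simp only [mul_left_comm (exp (-(T * n))), ← exp_sum, ← exp_add, ← Finset.mul_sum]
          refine mul_le_mul_of_nonneg_left ?_ hpn
          split_ifs with hpass
          · obtain ⟨φ, hφ, hlt⟩ := hpass
            refine le_trans ?_ (Finset.single_le_sum
              (f := fun φ : X → B → ℝ => exp (-(T * n) + ∑ i, φ (x i) (y i)))
              (fun φ _ => (exp_pos _).le) hφ)
            rw [one_le_exp_iff]
            linarith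
          · exact Finset.sum_nonneg fun φ _ => (exp_pos _).le
      _ = ∑ φ ∈ J, exp (-(T * n)) * ∏ i, ∑ a, p a * exp (φ a (y i)) := by
          rw [Finset.sum_comm]
          refine Finset.sum_congr rfl fun φ _ => ?_
          rw [← Finset.mul_sum, sum_prod_mul_prod (fun _ => p) fun i a => exp (φ a (y i))]
      _ ≤ ∑ φ ∈ J, exp (-(T * n)) := by
          refine Finset.sum_le_sum fun φ hφ => mul_le_of_le_one_right (exp_pos _).le ?_
          exact Finset.prod_le_one (fun i _ => Finset.sum_nonneg fun a _ =>
            mul_nonneg (hp.1 a) (exp_pos _).le) fun i _ => hJ1 φ hφ (y i)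
      _ = _ := by rw [Finset.sum_const, nsmul_eq_mul]

end

/-! ### Random coding -/

section

variable {X S B : Type*} [Fintype X] [Fintype S] [Fintype B] {n M L : ℕ}

open Classical in
/-- A bound on `M` times the error probability of threshold decoding within bins, as a function of
the codebook `C` alone: the number of codewords that are not `good`, plus the expected number of
wrong codewords of the right bin that pass the test, summed over state sequences with weight
`F`. -/
noncomputable def failureWeight {X S B : Type*} [Fintype S] [Fintype B] {n M L : ℕ}
    (K : X → S → B → ℝ) (F : (Fin n → S) → ℝ)
    (pass : (Fin n → X) → (Fin n → B) → Prop) (good : (Fin n → X) → Prop) (b : Fin M → Fin L)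
    (C : Fin M → Fin n → X) : ℝ :=
  ∑ m, ((if good (C m) then 0 else 1) + ∑ s, F s * ∑ y : Fin n → B,
    (∏ i, K (C m i) (s i) (y i)) *
      ∑ m' ∈ Finset.univ.filter fun m' => m' ≠ m ∧ b m' = b m, if pass (C m') y then 1 else 0)

open Classical in
/-- The mean of `failureWeight` over an i.i.d. codebook: distinct codewords are independent. -/
lemma sum_mul_failureWeight_le {p : X → ℝ} (hp : p ∈ stdSimplex ℝ X) {K : X → S → B → ℝ}
    (hK : ∀ x s, K x s ∈ stdSimplex ℝ B) {F : (Fin n → S) → ℝ} (hF : ∀ s, 0 ≤ F s)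
    {pass : (Fin n → X) → (Fin n → B) → Prop} {good : (Fin n → X) → Prop} {b : Fin M → Fin L}
    {ε β D : ℝ} (hβ : 0 ≤ β)
    (hgood : (∑ x : Fin n → X, (∏ i, p (x i)) * (if good x then 0 else 1)) ≤ ε)
    (hpass : ∀ y, ∑ x : Fin n → X, (∏ i, p (x i)) * (if pass x y then 1 else 0) ≤ β)
    (hD : ∀ m, ((Finset.univ.filter fun m' => m' ≠ m ∧ b m' = b m).card : ℝ) ≤ D) :
    ∑ C : Fin M → Fin n → X, (∏ m, ∏ i, p (C m i)) * failureWeight K F pass good b C ≤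
      M * (ε + (∑ s, F s) * (D * β)) := by
  have hP1 : ∀ _ : Fin M, ∑ x : Fin n → X, ∏ i, p (x i) = 1 := fun _ =>
    sum_prod_eq_one fun _ => hp.2
  have hPn : ∀ x : Fin n → X, 0 ≤ ∏ i, p (x i) := fun x => Finset.prod_nonneg fun i _ => hp.1 _
  have hKn : ∀ (x : Fin n → X) (s : Fin n → S) (y : Fin n → B), 0 ≤ ∏ i, K (x i) (s i) (y i) :=
    fun x s y => Finset.prod_nonneg fun i _ => (hK _ _).1 _
  simp only [failureWeight, Finset.mul_sum, mul_add]
  rw [Finset.sum_comm]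
  have key : ∀ m : Fin M, ∑ C : Fin M → Fin n → X, ((∏ m, ∏ i, p (C m i)) *
      (if good (C m) then 0 else 1) + ∑ s, ∑ y : Fin n → B,
        ∑ m' ∈ Finset.univ.filter fun m' => m' ≠ m ∧ b m' = b m, (∏ m, ∏ i, p (C m i)) * (F s *
          ((∏ i, K (C m i) (s i) (y i)) * if pass (C m') y then 1 else 0))) ≤
      ε + (∑ s, F s) * (D * β) := by
    intro m
    rw [Finset.sum_add_distrib]
    refine add_le_add ?_ ?_
    · refine le_trans (le_of_eq ?_) hgood
      exact sum_prod_mul_apply (P := fun (_ : Fin M) (x : Fin n → X) => ∏ i, p (x i)) hP1 m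
        (fun x => if good x then 0 else 1)
    · calc _ = ∑ s, F s * ∑ y : Fin n → B,
            ∑ m' ∈ Finset.univ.filter fun m' => m' ≠ m ∧ b m' = b m,
              ∑ C : Fin M → Fin n → X, (∏ m, ∏ i, p (C m i)) *
                ((∏ i, K (C m i) (s i) (y i)) * if pass (C m') y then 1 else 0) := by
            rw [Finset.sum_comm]
            refine Finset.sum_congr rfl fun s _ => ?_
            rw [Finset.sum_comm, Finset.mul_sum]
            refine Finset.sum_congr rfl fun y _ => ?_
            rw [Finset.sum_comm, Finset.mul_sum]
            refine Finset.sum_congr rfl fun m' _ => ?_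
            rw [Finset.mul_sum]
            exact Finset.sum_congr rfl fun C _ => by ring
        _ ≤ ∑ s, F s * ∑ y : Fin n → B,
            ∑ m' ∈ Finset.univ.filter fun m' => m' ≠ m ∧ b m' = b m,
              (∑ x : Fin n → X, (∏ i, p (x i)) * ∏ i, K (x i) (s i) (y i)) * β := by
            refine Finset.sum_le_sum fun s _ => mul_le_mul_of_nonneg_left ?_ (hF s)
            refine Finset.sum_le_sum fun y _ => Finset.sum_le_sum fun m' hm' => ?_
            have hne := (Finset.mem_filter.1 hm').2.1
            rw [sum_prod_mul_apply_mul_apply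
              (P := fun (_ : Fin M) (x : Fin n → X) => ∏ i, p (x i)) hP1 hne.symm
              (fun x => ∏ i, K (x i) (s i) (y i)) (fun x => if pass x y then 1 else 0)]
            exact mul_le_mul_of_nonneg_left (hpass y)
              (Finset.sum_nonneg fun x _ => mul_nonneg (hPn x) (hKn x s y))
        _ ≤ ∑ s, F s * (D * β) := by
            refine Finset.sum_le_sum fun s _ => mul_le_mul_of_nonneg_left ?_ (hF s)
            simp only [Finset.sum_const, nsmul_eq_mul]
            rw [← Finset.mul_sum, ← Finset.sum_mul, Finset.sum_comm]
            have : ∑ x : Fin n → X, ∑ y : Fin n → B,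
                (∏ i, p (x i)) * ∏ i, K (x i) (s i) (y i) = 1 := by
              rw [← sum_prod_eq_one (ι := Fin n) (P := fun _ => p) fun _ => hp.2]
              refine Finset.sum_congr rfl fun x _ => ?_
              rw [← Finset.mul_sum, sum_prod_eq_one (P := fun i => K (x i) (s i))
                fun i => (hK _ _).2, mul_one]
            rw [this, one_mul]
            exact mul_le_mul_of_nonneg_right (hD m) hβ
        _ = _ := by rw [Finset.sum_mul]
  refine (Finset.sum_le_sum fun m _ => key m).trans (le_of_eq ?_)
  simp

/-- Threshold decoding within a bin, for all state laws in `Q` at once. -/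
lemma exists_decoder {X S B : Type*} [Fintype S] [Fintype B] {n M L : ℕ} {K : X → S → B → ℝ}
    (hK : ∀ x s, K x s ∈ stdSimplex ℝ B) {Q : Set (S → ℝ)} (hQ : Q ⊆ stdSimplex ℝ S)
    {F : (Fin n → S) → ℝ} (hF : ∀ q ∈ stdSimplex ℝ S, ∀ s, ∏ i, q (s i) ≤ F s)
    {pass : (Fin n → X) → (Fin n → B) → Prop} {good : (Fin n → X) → Prop} (b : Fin M → Fin L)
    {ε : ℝ} (hε : 0 ≤ ε) (hM : 0 < M) (C : Fin M → Fin n → X)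
    (hpass : ∀ x, good x → ∀ q ∈ Q, ∑ y, blockProb (mixChannel K q) x y *
      (open Classical in if pass x y then 0 else 1) ≤ ε) :
    ∃ d : (Fin n → B) → Fin L → Fin M, ∀ q ∈ Q,
      ∑ m, ∑ y, (if d y (b m) ≠ m then blockProb (mixChannel K q) (C m) y else 0) ≤
        failureWeight K F pass good b C + M * ε := by
  classical
  -- decode to any codeword of the bin that passes; uniqueness is not required
  let d : (Fin n → B) → Fin L → Fin M := fun y l =>
    if h : ∃ m, b m = l ∧ pass (C m) y then h.choose else ⟨0, hM⟩
  refine ⟨d, fun q hq => ?_⟩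
  have hqs := hQ hq
  have hbp := fun m y => blockProb_nonneg (mixChannel_mem hK hqs) (C m) y
  have hMε : (M : ℝ) * ε = ∑ _m : Fin M, ε := by simp
  rw [hMε, failureWeight, ← Finset.sum_add_distrib]
  refine Finset.sum_le_sum fun m _ => ?_
  let W : (Fin n → B) → ℝ := fun y =>
    ∑ m' ∈ Finset.univ.filter fun m' => m' ≠ m ∧ b m' = b m, if pass (C m') y then 1 else 0
  have hW : ∀ y, 0 ≤ W y := fun y => Finset.sum_nonneg fun m' _ => by split_ifs <;> norm_num
  have hd : ∀ y, (if d y (b m) ≠ m then blockProb (mixChannel K q) (C m) y else 0) ≤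
      blockProb (mixChannel K q) (C m) y * (if pass (C m) y then 0 else 1) +
        blockProb (mixChannel K q) (C m) y * W y := by
    intro y
    rw [← mul_add]
    split_ifs with h1 h2 h2
    · refine le_mul_of_one_le_right (hbp m y) ?_
      have hex : ∃ m', b m' = b m ∧ pass (C m') y := ⟨m, rfl, h2⟩
      have hdy : d y (b m) = hex.choose := dif_pos hex
      have hs := hex.choose_spec
      rw [← hdy] at hs
      rw [zero_add]
      refine le_trans ?_ (Finset.single_le_sum (f := fun m' => if pass (C m') y then (1 : ℝ) else 0)
        (fun m' _ => by split_ifs <;> norm_num)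
        (Finset.mem_filter.2 ⟨Finset.mem_univ (d y (b m)), h1, hs.1⟩))
      rw [if_pos hs.2]
    · exact le_mul_of_one_le_right (hbp m y) (by linarith [hW y])
    · exact mul_nonneg (hbp m y) (by linarith [hW y])
    · exact mul_nonneg (hbp m y) (by linarith [hW y])
  refine (Finset.sum_le_sum fun y _ => hd y).trans ?_
  rw [Finset.sum_add_distrib]
  have h1 : ∑ y, blockProb (mixChannel K q) (C m) y * (if pass (C m) y then 0 else 1) ≤
      (if good (C m) then 0 else 1) + ε := by
    by_cases hg : good (C m)
    · rw [if_pos hg, zero_add]; exact hpass _ hg q hq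
    · rw [if_neg hg]
      refine le_trans ?_ (le_add_of_nonneg_right hε)
      refine le_of_le_of_eq ?_ (sum_blockProb (mixChannel_mem hK hqs) (C m))
      refine Finset.sum_le_sum fun y _ => mul_le_of_le_one_right (hbp m y) ?_
      split_ifs <;> norm_num
  have h2 : ∑ y, blockProb (mixChannel K q) (C m) y * W y ≤
      ∑ s, F s * ∑ y : Fin n → B, (∏ i, K (C m i) (s i) (y i)) * W y := by
    have e : ∀ y, blockProb (mixChannel K q) (C m) y =
        ∑ s : Fin n → S, (∏ i, q (s i)) * ∏ i, K (C m i) (s i) (y i) := by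
      intro y
      rw [sum_prod_mul_prod (fun _ => q) fun i s => K (C m i) s (y i)]
      rfl
    simp only [e, Finset.sum_mul, mul_assoc]
    rw [Finset.sum_comm]
    refine Finset.sum_le_sum fun s _ => ?_
    rw [← Finset.mul_sum]
    refine mul_le_mul_of_nonneg_right (hF q hqs s) (Finset.sum_nonneg fun y _ => mul_nonneg ?_ (hW y))
    exact Finset.prod_nonneg fun i _ => (hK _ _).1 _
  linarith

end

lemma exists_le_of_sum_mul_le {ι : Type*} [Fintype ι] {w f : ι → ℝ} (hw : ∀ i, 0 ≤ w i)
    (hw1 : ∑ i, w i = 1) {a : ℝ} (h : ∑ i, w i * f i ≤ a) : ∃ i, f i ≤ a := by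
  by_contra! hlt
  obtain ⟨i, -, hi⟩ := Finset.exists_ne_zero_of_sum_ne_zero (hw1.trans_ne one_ne_zero)
  have : ∑ i, w i * a < ∑ i, w i * f i := Finset.sum_lt_sum
    (fun j _ => mul_le_mul_of_nonneg_left (hlt j).le (hw j))
    ⟨i, Finset.mem_univ i, mul_lt_mul_of_pos_left (hlt i) (lt_of_le_of_ne (hw i) hi.symm)⟩
  rw [← Finset.sum_mul, hw1, one_mul] at this
  linarith

/-- Binning `M` messages by their residues modulo `L` gives each message at most `M / L` competitors
in its bin. -/
lemma card_bin_le {M L : ℕ} (hL : 0 < L) (m : Fin M) :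
    ((Finset.univ.filter fun m' : Fin M => m' ≠ m ∧
      (⟨m' % L, Nat.mod_lt _ hL⟩ : Fin L) = ⟨m % L, Nat.mod_lt _ hL⟩).card : ℝ) ≤ M / L := by
  have hM : 0 < M := m.pos
  set A := Finset.univ.filter fun m' : Fin M => m' ≠ m ∧
      (⟨m' % L, Nat.mod_lt _ hL⟩ : Fin L) = ⟨m % L, Nat.mod_lt _ hL⟩ with hA
  have hmA : m ∉ A := by simp [hA]
  have hcard : (insert m A).card ≤ (M - 1) / L + 1 := by
    rw [← Finset.card_range ((M - 1) / L + 1)]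
    refine Finset.card_le_card_of_injOn (fun m' : Fin M => (m' : ℕ) / L) ?_ ?_
    · intro m' _
      have : (m' : ℕ) ≤ M - 1 := Nat.le_sub_one_of_lt m'.2
      simpa [Nat.lt_succ_iff] using Nat.div_le_div_right (c := L) this
    · have hmod : ∀ m' ∈ insert m A, (m' : ℕ) % L = m % L := by
        intro m' hm'
        rcases Finset.mem_insert.1 hm' with h | h
        · rw [h]
        · simpa using (Finset.mem_filter.1 h).2.2
      intro m₁ h₁ m₂ h₂ h
      simp only at h
      apply Fin.ext
      rw [← Nat.div_add_mod (m₁ : ℕ) L, ← Nat.div_add_mod (m₂ : ℕ) L, h, hmod m₁ h₁, hmod m₂ h₂]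
  rw [Finset.card_insert_of_notMem hmA] at hcard
  have h1 : A.card ≤ M / L :=
    (Nat.le_of_succ_le_succ hcard).trans (Nat.div_le_div_right (Nat.sub_le _ _))
  exact (Nat.cast_le.2 h1).trans Nat.cast_div_le

section

variable {X S Y Y₁ : Type*} [Fintype S] [Fintype Y] [Fintype Y₁]

/-- The law of the receiver's output given input and state. -/
def Channel.receiver (W : Channel X S Y Y₁) (x : X) (s : S) (y : Y) : ℝ := ∑ y₁, W.W x s (y, y₁)

/-- The law of the relay's observation given input and state. -/
def Channel.relayObs (W : Channel X S Y Y₁) (x : X) (s : S) (y₁ : Y₁) : ℝ := ∑ y, W.W x s (y, y₁)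

lemma receiver_mem {X S Y Y₁ : Type*} [Fintype Y] [Fintype Y₁] (W : Channel X S Y Y₁) (x : X)
    (s : S) : W.receiver x s ∈ stdSimplex ℝ Y := by
  refine ⟨fun y => Finset.sum_nonneg fun y₁ _ => (W.mem_simplex x s).1 _, ?_⟩
  rw [← (W.mem_simplex x s).2, Fintype.sum_prod_type]
  rfl

lemma relayObs_mem {X S Y Y₁ : Type*} [Fintype Y] [Fintype Y₁] (W : Channel X S Y Y₁) (x : X)
    (s : S) : W.relayObs x s ∈ stdSimplex ℝ Y₁ := by
  refine ⟨fun y => Finset.sum_nonneg fun y₁ _ => (W.mem_simplex x s).1 _, ?_⟩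
  rw [← (W.mem_simplex x s).2, Fintype.sum_prod_type_right]
  rfl

lemma mixChannel_receiver (W : Channel X S Y Y₁) (q : S → ℝ) :
    mixChannel W.receiver q = W.avgY q := by
  funext x y
  simp only [mixChannel, Channel.receiver, Channel.avgY, Channel.avg, Finset.mul_sum]
  exact Finset.sum_comm

lemma mixChannel_relayObs (W : Channel X S Y Y₁) (q : S → ℝ) :
    mixChannel W.relayObs q = W.avgY₁ q := by
  funext x y
  simp only [mixChannel, Channel.relayObs, Channel.avgY₁, Channel.avg, Finset.mul_sum]
  exact Finset.sum_comm

lemma two_rpow_eq_exp (n : ℕ) (R : ℝ) : (2 : ℝ) ^ ((n : ℝ) * R) = exp (R * log 2 * n) := by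
  rw [rpow_def_of_pos two_pos]; congr 1; ring

lemma natCeil_two_rpow_le {n : ℕ} {R : ℝ} (hR : 0 ≤ R) :
    (⌈(2 : ℝ) ^ ((n : ℝ) * R)⌉₊ : ℝ) ≤ 2 * exp (R * log 2 * n) := by
  have h1 : (1 : ℝ) ≤ (2 : ℝ) ^ ((n : ℝ) * R) := one_le_rpow one_le_two (by positivity)
  have := (Nat.ceil_lt_add_one (zero_le_one.trans h1)).le
  rw [two_rpow_eq_exp] at *
  linarith

lemma exp_le_two_mul_natFloor {n : ℕ} {C : ℝ} (hC : 0 ≤ C) :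
    exp (C * log 2 * n) ≤ 2 * (⌊(2 : ℝ) ^ ((n : ℝ) * C)⌋₊ : ℝ) := by
  have h1 : (1 : ℝ) ≤ (2 : ℝ) ^ ((n : ℝ) * C) := one_le_rpow one_le_two (by positivity)
  have h2 : (1 : ℝ) ≤ (⌊(2 : ℝ) ^ ((n : ℝ) * C)⌋₊ : ℝ) := by
    exact_mod_cast Nat.floor_pos.2 h1
  have := Nat.lt_floor_add_one ((2 : ℝ) ^ ((n : ℝ) * C))
  rw [two_rpow_eq_exp] at *
  linarith

variable [Fintype X]

/-- Achievability without the help of the relay, over the compound channel from sender to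
receiver. -/
lemma achievable_of_lt_channelInfo (W : Channel X S Y Y₁) {C₁ : ℝ} (hC₁ : 0 ≤ C₁)
    {Q : Set (S → ℝ)} (hQ : Q ⊆ stdSimplex ℝ S) (hQne : Q.Nonempty) (hQc : IsCompact Q)
    {p : X → ℝ} (hp : p ∈ stdSimplex ℝ X) {R v : ℝ} (hR : 0 ≤ R) (hRv : R < v)
    (hv : ∀ q ∈ Q, v ≤ channelInfo p (W.avgY q)) : W.Achievable C₁ Q R := by
  have hl2 : 0 < log 2 := log_pos one_lt_two
  refine ⟨hR, fun ε hε => ?_⟩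
  obtain ⟨c, hc, htest⟩ := exists_test hp (receiver_mem W) hQ hQc hQne
    (T := (R + v) / 2 * log 2) fun q hq => by
      rw [mixChannel_receiver]
      exact mul_lt_mul_of_pos_right (by linarith [hv q hq]) hl2
  have hε3 : 0 < ε / 3 := by linarith
  obtain ⟨N₁, hN₁⟩ := htest (ε / 3) hε3
  obtain ⟨N₂, hN₂⟩ := exists_forall_pow_mul_exp_le (Fintype.card S) (2 * c)
    (γ := (v - R) / 2 * log 2) (mul_pos (by linarith) hl2) hε3
  refine ⟨max N₁ N₂, fun n hn => ?_⟩
  obtain ⟨pass, good, hgood, hown, hother⟩ := hN₁ n ((le_max_left _ _).trans hn)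
  have hexp := hN₂ n ((le_max_right _ _).trans hn)
  have hMle := natCeil_two_rpow_le (n := n) hR
  have hM0 : 0 < ⌈(2 : ℝ) ^ ((n : ℝ) * R)⌉₊ := Nat.ceil_pos.2 (by positivity)
  have hL0 : 0 < ⌊(2 : ℝ) ^ ((n : ℝ) * C₁)⌋₊ :=
    Nat.floor_pos.2 (one_le_rpow one_le_two (by positivity))
  generalize ⌈(2 : ℝ) ^ ((n : ℝ) * R)⌉₊ = M at hMle hM0 ⊢
  generalize ⌊(2 : ℝ) ^ ((n : ℝ) * C₁)⌋₊ = L at hL0 ⊢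
  have hMr : (0 : ℝ) < M := by exact_mod_cast hM0
  obtain ⟨F, hF0, hFsum, hFq⟩ := exists_weight_dominating_iid S n
  let b : Fin M → Fin 1 := fun _ => 0
  have havg := sum_mul_failureWeight_le (b := b) (D := M) hp (receiver_mem W) hF0
    (mul_nonneg hc (exp_pos _).le) hgood hother
    fun m => by exact_mod_cast (Finset.card_filter_le _ _).trans (by simp)
  obtain ⟨C, hC⟩ := exists_le_of_sum_mul_le
    (fun C : Fin M → Fin n → X => Finset.prod_nonneg fun m _ => Finset.prod_nonneg fun i _ =>
      hp.1 (C m i))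
    (sum_prod_eq_one (P := fun (_ : Fin M) (x : Fin n → X) => ∏ i, p (x i)) fun _ =>
      sum_prod_eq_one fun _ => hp.2) havg
  obtain ⟨d, hd⟩ := exists_decoder (receiver_mem W) hQ hFq b hε3.le hM0 C hown
  refine ⟨⟨C, fun _ => ⟨0, hL0⟩, fun y _ => d y 0⟩, fun q hq => ?_⟩
  rw [error_eq, one_div, inv_mul_le_iff₀ hMr]
  have h1 : (∑ s, F s) * (M * (c * exp (-((R + v) / 2 * log 2 * n)))) ≤ ε / 3 := by
    refine le_trans ?_ hexp
    refine mul_le_mul hFsum ?_ (mul_nonneg hMr.le (mul_nonneg hc (exp_pos _).le)) (by positivity)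
    calc (M : ℝ) * (c * exp (-((R + v) / 2 * log 2 * n)))
        ≤ (2 * exp (R * log 2 * n)) * (c * exp (-((R + v) / 2 * log 2 * n))) :=
          mul_le_mul_of_nonneg_right hMle (mul_nonneg hc (exp_pos _).le)
      _ = 2 * c * (exp (R * log 2 * n) * exp (-((R + v) / 2 * log 2 * n))) := by ring
      _ = 2 * c * exp (-((v - R) / 2 * log 2) * n) := by rw [← exp_add]; ring_nf
  have h2 := hd q hq
  have h3 : failureWeight W.receiver F pass good b C + M * (ε / 3) ≤ M * ε := by
    have := mul_le_mul_of_nonneg_left h1 hMr.le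
    linarith
  refine le_trans (le_of_eq ?_) (h2.trans h3)
  refine Finset.sum_congr rfl fun m _ => Finset.sum_congr rfl fun y _ => ?_
  simp only [b, mixChannel_receiver]
  split_ifs
  · exact sum_blockProb_pair W q _ y
  · simp

/-- Decode-forward with the relay decoding the whole message: the relay sends the index of the bin
of the message, and the receiver decodes within this bin. -/
lemma achievable_of_lt_relay (W : Channel X S Y Y₁) {C₁ : ℝ} (hC₁ : 0 ≤ C₁)
    {Q : Set (S → ℝ)} (hQ : Q ⊆ stdSimplex ℝ S) (hQne : Q.Nonempty) (hQc : IsCompact Q)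
    {p : X → ℝ} (hp : p ∈ stdSimplex ℝ X) {R v : ℝ} (hR : 0 ≤ R) (hRv : R < v)
    (hv : ∀ q ∈ Q, v ≤ channelInfo p (W.avgY q) + C₁)
    (hv₁ : ∀ q ∈ Q, v ≤ channelInfo p (W.avgY₁ q)) : W.Achievable C₁ Q R := by
  have hl2 : 0 < log 2 := log_pos one_lt_two
  refine ⟨hR, fun ε hε => ?_⟩
  -- the bin index carries rate `C₁`, which lowers the threshold needed at the receiver
  obtain ⟨c, hc, htest⟩ := exists_test hp (receiver_mem W) hQ hQc hQne
    (T := ((R + v) / 2 - C₁) * log 2) fun q hq => by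
      rw [mixChannel_receiver]
      exact mul_lt_mul_of_pos_right (by linarith [hv q hq]) hl2
  obtain ⟨c', hc', htest'⟩ := exists_test hp (relayObs_mem W) hQ hQc hQne
    (T := (R + v) / 2 * log 2) fun q hq => by
      rw [mixChannel_relayObs]
      exact mul_lt_mul_of_pos_right (by linarith [hv₁ q hq]) hl2
  have hε6 : 0 < ε / 6 := by linarith
  obtain ⟨N₁, hN₁⟩ := htest (ε / 6) hε6
  obtain ⟨N₁', hN₁'⟩ := htest' (ε / 6) hε6
  have hγ : 0 < (v - R) / 2 * log 2 := mul_pos (by linarith) hl2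
  obtain ⟨N₂, hN₂⟩ := exists_forall_pow_mul_exp_le (Fintype.card S) (4 * c) hγ hε6
  obtain ⟨N₂', hN₂'⟩ := exists_forall_pow_mul_exp_le (Fintype.card S) (2 * c') hγ hε6
  refine ⟨max (max N₁ N₁') (max N₂ N₂'), fun n hn => ?_⟩
  simp only [max_le_iff] at hn
  obtain ⟨pass, good, hgood, hown, hother⟩ := hN₁ n hn.1.1
  obtain ⟨pass', good', hgood', hown', hother'⟩ := hN₁' n hn.1.2
  have hexp := hN₂ n hn.2.1
  have hexp' := hN₂' n hn.2.2
  have hMle := natCeil_two_rpow_le (n := n) hR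
  have hM0 : 0 < ⌈(2 : ℝ) ^ ((n : ℝ) * R)⌉₊ := Nat.ceil_pos.2 (by positivity)
  have hL0 : 0 < ⌊(2 : ℝ) ^ ((n : ℝ) * C₁)⌋₊ :=
    Nat.floor_pos.2 (one_le_rpow one_le_two (by positivity))
  have hLge := exp_le_two_mul_natFloor (n := n) hC₁
  generalize ⌈(2 : ℝ) ^ ((n : ℝ) * R)⌉₊ = M at hMle hM0 ⊢
  generalize ⌊(2 : ℝ) ^ ((n : ℝ) * C₁)⌋₊ = L at hL0 hLge ⊢
  have hMr : (0 : ℝ) < M := by exact_mod_cast hM0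
  have hLr : (0 : ℝ) < L := by exact_mod_cast hL0
  obtain ⟨F, hF0, hFsum, hFq⟩ := exists_weight_dominating_iid S n
  let b : Fin M → Fin L := fun m => ⟨m % L, Nat.mod_lt _ hL0⟩
  let b' : Fin M → Fin 1 := fun _ => 0
  have havg := sum_mul_failureWeight_le (b := b) (D := M / L) hp (receiver_mem W) hF0
    (mul_nonneg hc (exp_pos _).le) hgood hother (card_bin_le hL0)
  have havg' := sum_mul_failureWeight_le (b := b') (D := M) hp (relayObs_mem W) hF0
    (mul_nonneg hc' (exp_pos _).le) hgood' hother'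
    fun m => by exact_mod_cast (Finset.card_filter_le _ _).trans (by simp)
  have hsum := add_le_add havg havg'
  simp only [← Finset.sum_add_distrib, ← mul_add] at hsum
  obtain ⟨C, hC⟩ := exists_le_of_sum_mul_le
    (fun C : Fin M → Fin n → X => Finset.prod_nonneg fun m _ => Finset.prod_nonneg fun i _ =>
      hp.1 (C m i))
    (sum_prod_eq_one (P := fun (_ : Fin M) (x : Fin n → X) => ∏ i, p (x i)) fun _ =>
      sum_prod_eq_one fun _ => hp.2) hsum
  obtain ⟨d, hd⟩ := exists_decoder (receiver_mem W) hQ hFq b hε6.le hM0 C hown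
  obtain ⟨d', hd'⟩ := exists_decoder (relayObs_mem W) hQ hFq b' hε6.le hM0 C hown'
  refine ⟨⟨C, fun y₁ => b (d' y₁ 0), d⟩, fun q hq => ?_⟩
  rw [error_eq, one_div, inv_mul_le_iff₀ hMr]
  have h1 : (∑ s, F s) * (M / L * (c * exp (-(((R + v) / 2 - C₁) * log 2 * n)))) ≤ ε / 6 := by
    refine le_trans ?_ hexp
    refine mul_le_mul hFsum ?_ (by positivity) (by positivity)
    have hML : (M : ℝ) / L ≤ 4 * exp (R * log 2 * n) * exp (-(C₁ * log 2 * n)) := by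
      rw [div_le_iff₀ hLr]
      calc (M : ℝ) ≤ 2 * exp (R * log 2 * n) := hMle
        _ = 2 * exp (R * log 2 * n) * exp (-(C₁ * log 2 * n)) * exp (C₁ * log 2 * n) := by
          rw [mul_assoc (2 * _), ← exp_add, neg_add_cancel, exp_zero, mul_one]
        _ ≤ 2 * exp (R * log 2 * n) * exp (-(C₁ * log 2 * n)) * (2 * L) :=
          mul_le_mul_of_nonneg_left hLge (by positivity)
        _ = _ := by ring
    calc (M : ℝ) / L * (c * exp (-(((R + v) / 2 - C₁) * log 2 * n)))
        ≤ 4 * exp (R * log 2 * n) * exp (-(C₁ * log 2 * n)) *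
            (c * exp (-(((R + v) / 2 - C₁) * log 2 * n))) :=
          mul_le_mul_of_nonneg_right hML (by positivity)
      _ = 4 * c * (exp (R * log 2 * n) * exp (-(C₁ * log 2 * n)) *
            exp (-(((R + v) / 2 - C₁) * log 2 * n))) := by ring
      _ = 4 * c * exp (-((v - R) / 2 * log 2) * n) := by
          rw [← exp_add, ← exp_add]; ring_nf
  have h1' : (∑ s, F s) * (M * (c' * exp (-((R + v) / 2 * log 2 * n)))) ≤ ε / 6 := by
    refine le_trans ?_ hexp'
    refine mul_le_mul hFsum ?_ (by positivity) (by positivity)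
    calc (M : ℝ) * (c' * exp (-((R + v) / 2 * log 2 * n)))
        ≤ (2 * exp (R * log 2 * n)) * (c' * exp (-((R + v) / 2 * log 2 * n))) :=
          mul_le_mul_of_nonneg_right hMle (by positivity)
      _ = 2 * c' * (exp (R * log 2 * n) * exp (-((R + v) / 2 * log 2 * n))) := by ring
      _ = 2 * c' * exp (-((v - R) / 2 * log 2) * n) := by rw [← exp_add]; ring_nf
  have h3 : failureWeight W.receiver F pass good b C + M * (ε / 6) +
      (failureWeight W.relayObs F pass' good' b' C + M * (ε / 6)) ≤ M * ε := by
    have e1 := mul_le_mul_of_nonneg_left h1 hMr.le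
    have e2 := mul_le_mul_of_nonneg_left h1' hMr.le
    linarith
  refine le_trans ?_ ((add_le_add (hd q hq) (hd' q hq)).trans h3)
  rw [← Finset.sum_add_distrib]
  refine Finset.sum_le_sum fun m _ => ?_
  simp only [mixChannel_receiver, mixChannel_relayObs, ← sum_blockProb_pair,
    ← sum_blockProb_pair']
  have hn := fun (y : Fin n → Y) (y₁ : Fin n → Y₁) =>
    blockProb_nonneg (avg_mem W (hQ hq)) (C m) fun i => (y i, y₁ i)
  calc _ ≤ ∑ y : Fin n → Y, ∑ y₁ : Fin n → Y₁,
        ((if d y (b m) ≠ m then blockProb (W.avg q) (C m) (fun i => (y i, y₁ i)) else 0) +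
          if d' y₁ 0 ≠ m then blockProb (W.avg q) (C m) (fun i => (y i, y₁ i)) else 0) := by
        refine Finset.sum_le_sum fun y _ => Finset.sum_le_sum fun y₁ _ => ?_
        have := hn y y₁
        by_cases hr : d' y₁ 0 = m
        · simp [hr]
        · rw [if_pos hr]
          split_ifs <;> linarith
    _ = _ := by
        simp only [Finset.sum_add_distrib]
        congr 1
        · refine Finset.sum_congr rfl fun y _ => ?_
          split_ifs <;> simp
        · rw [Finset.sum_comm]
          refine Finset.sum_congr rfl fun y₁ _ => ?_
          simp only [b']
          split_ifs <;> simp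

end

/-! ### Saddle points -/

section

variable {E E' : Type*} {s : Set E} {t : Set E'} {f : E → E' → ℝ} {a : E} {b : E'}

lemma IsSaddlePointOn.iSup_eq (h : IsSaddlePointOn s t f a b) (ha : a ∈ s) (hb : b ∈ t) :
    ⨆ y : t, f a y = f a b := by
  have : Nonempty t := ⟨⟨b, hb⟩⟩
  refine le_antisymm (ciSup_le fun y => h a ha y y.2) ?_
  exact le_ciSup (f := fun y : t => f a y) ⟨f a b, by rintro _ ⟨y, rfl⟩; exact h a ha y y.2⟩ ⟨b, hb⟩

lemma IsSaddlePointOn.iInf_eq (h : IsSaddlePointOn s t f a b) (ha : a ∈ s) (hb : b ∈ t) :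
    ⨅ x : s, f x b = f a b := by
  have : Nonempty s := ⟨⟨a, ha⟩⟩
  refine le_antisymm ?_ (le_ciInf fun x => h x x.2 b hb)
  exact ciInf_le (f := fun x : s => f x b) ⟨f a b, by rintro _ ⟨x, rfl⟩; exact h x x.2 b hb⟩ ⟨a, ha⟩

lemma IsSaddlePointOn.isMinOn_iSup (h : IsSaddlePointOn s t f a b) (ha : a ∈ s) (hb : b ∈ t)
    (hbdd : ∀ x ∈ s, BddAbove (Set.range fun y : t => f x y)) :
    IsMinOn (fun x => ⨆ y : t, f x y) s a := fun x hx => by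
  change ⨆ y : t, f a y ≤ ⨆ y : t, f x y
  rw [IsSaddlePointOn.iSup_eq h ha hb]
  exact (h x hx b hb).trans (le_ciSup (hbdd x hx) ⟨b, hb⟩)

lemma IsSaddlePointOn.isMaxOn_iInf (h : IsSaddlePointOn s t f a b) (ha : a ∈ s) (hb : b ∈ t)
    (hbdd : ∀ y ∈ t, BddBelow (Set.range fun x : s => f x y)) :
    IsMaxOn (fun y => ⨅ x : s, f x y) t b := fun y hy => by
  change ⨅ x : s, f x y ≤ ⨅ x : s, f x b
  rw [IsSaddlePointOn.iInf_eq h ha hb]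
  exact (ciInf_le (hbdd y hy) ⟨a, ha⟩).trans (h a ha y hy)

lemma iInf_eq_of_isMinOn {g : E → ℝ} (ha : a ∈ s) (h : IsMinOn g s a) : ⨅ x : s, g x = g a := by
  have : Nonempty s := ⟨⟨a, ha⟩⟩
  exact le_antisymm (ciInf_le (f := fun x : s => g x)
    ⟨g a, by rintro _ ⟨x, rfl⟩; exact h x.2⟩ ⟨a, ha⟩) (le_ciInf fun x => h x.2)

lemma iSup_eq_of_isMaxOn {g : E → ℝ} (ha : a ∈ s) (h : IsMaxOn g s a) : ⨆ x : s, g x = g a := by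
  have : Nonempty s := ⟨⟨a, ha⟩⟩
  exact le_antisymm (ciSup_le fun x => h x.2) (le_ciSup (f := fun x : s => g x)
    ⟨g a, by rintro _ ⟨x, rfl⟩; exact h x.2⟩ ⟨a, ha⟩)

end

section

variable {X S Y Y₁ : Type*} [Fintype X] [Fintype S] [Fintype Y] [Fintype Y₁]

/-! ### Regularity of the information quantities in the input and state laws -/

lemma continuous_avgY {X S Y Y₁ : Type*} [Fintype S] [Fintype Y] [Fintype Y₁]
    (W : Channel X S Y Y₁) : Continuous W.avgY := by
  have : W.avgY = mixChannel W.receiver := funext fun q => (mixChannel_receiver W q).symm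
  rw [this]
  exact continuous_mixChannel _

lemma continuousOn_channelInfo_input {B : Type*} [Fintype B] {K : X → B → ℝ}
    (hK : ∀ x, K x ∈ stdSimplex ℝ B) :
    ContinuousOn (fun p => channelInfo p K) (stdSimplex ℝ X) :=
  continuousOn_channelInfo (p := fun p => p) (K := fun _ => K) continuousOn_id continuousOn_const
    (fun _ hp => hp.1) fun _ _ => hK

lemma continuousOn_channelInfo_avgY (W : Channel X S Y Y₁) {p : X → ℝ} (hp : ∀ x, 0 ≤ p x) :
    ContinuousOn (fun q => channelInfo p (W.avgY q)) (stdSimplex ℝ S) :=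
  continuousOn_channelInfo continuousOn_const (continuous_avgY W).continuousOn (fun _ _ => hp)
    fun _ hq => avgY_mem W hq

lemma convexOn_channelInfo_avgY (W : Channel X S Y Y₁) {p : X → ℝ} (hp : ∀ x, 0 ≤ p x) :
    ConvexOn ℝ (stdSimplex ℝ S) fun q => channelInfo p (W.avgY q) := by
  refine ⟨convex_stdSimplex ℝ S, fun q hq q' hq' a b ha hb hab => ?_⟩
  have h : W.avgY (a • q + b • q') = a • W.avgY q + b • W.avgY q' := by
    simp only [← mixChannel_receiver]
    funext x y
    simp only [mixChannel, Pi.add_apply, Pi.smul_apply, smul_eq_mul, add_mul,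
      Finset.sum_add_distrib, Finset.mul_sum, mul_assoc]
  dsimp only
  rw [h]
  exact channelInfo_convex hp (avgY_mem W hq) (avgY_mem W hq') ha hb hab

lemma continuousOn_cutsetObjective (W : Channel X S Y Y₁) (C₁ : ℝ) {q : S → ℝ}
    (hq : q ∈ stdSimplex ℝ S) :
    ContinuousOn (fun p => W.cutsetObjective C₁ q p) (stdSimplex ℝ X) :=
  ContinuousOn.inf ((continuousOn_channelInfo_input (avgY_mem W hq)).add continuousOn_const)
    (continuousOn_channelInfo_input (avg_mem W hq))

lemma nonempty_stdSimplex (X : Type*) [Fintype X] [Nonempty X] : (stdSimplex ℝ X).Nonempty := by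
  classical
  exact ⟨_, single_mem_stdSimplex ℝ (Classical.arbitrary X)⟩

lemma exists_isMaxOn_cutsetObjective [Nonempty X] (W : Channel X S Y Y₁) (C₁ : ℝ) {q : S → ℝ}
    (hq : q ∈ stdSimplex ℝ S) : ∃ p ∈ stdSimplex ℝ X,
      IsMaxOn (fun p => W.cutsetObjective C₁ q p) (stdSimplex ℝ X) p :=
  (isCompact_stdSimplex ℝ X).exists_isMaxOn (nonempty_stdSimplex X)
    (continuousOn_cutsetObjective W C₁ hq)

/-! ### Capacity -/

lemma achievable_zero {X S Y Y₁ : Type*} [Fintype S] [Fintype Y] [Fintype Y₁] [Nonempty X]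
    (W : Channel X S Y Y₁) {C₁ : ℝ} (hC₁ : 0 ≤ C₁)
    (Q : Set (S → ℝ)) : W.Achievable C₁ Q 0 := by
  refine ⟨le_rfl, fun ε hε => ⟨0, fun n _ => ?_⟩⟩
  have hM : ⌈(2 : ℝ) ^ ((n : ℝ) * 0)⌉₊ = 1 := by simp
  have hL0 : 0 < ⌊(2 : ℝ) ^ ((n : ℝ) * C₁)⌋₊ :=
    Nat.floor_pos.2 (one_le_rpow one_le_two (by positivity))
  generalize ⌈(2 : ℝ) ^ ((n : ℝ) * 0)⌉₊ = M at hM ⊢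
  subst hM
  refine ⟨⟨fun _ _ => Classical.arbitrary X, fun _ => ⟨0, hL0⟩, fun _ _ => 0⟩, fun q _ => ?_⟩
  rw [error_eq]
  refine le_trans (le_of_eq ?_) hε.le
  simp [Subsingleton.elim _ (0 : Fin 1)]

lemma isLUB_capacity [Nonempty X] (W : Channel X S Y Y₁) {C₁ : ℝ} (hC₁ : 0 ≤ C₁)
    {Q : Set (S → ℝ)} (hQ : Q ⊆ stdSimplex ℝ S) (hQne : Q.Nonempty) :
    IsLUB {R | W.Achievable C₁ Q R} (W.capacity C₁ Q) := by
  obtain ⟨q, hq⟩ := hQne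
  obtain ⟨p, -, hmax⟩ := exists_isMaxOn_cutsetObjective W C₁ (hQ hq)
  exact isLUB_csSup ⟨0, achievable_zero W hC₁ Q⟩ ⟨W.cutsetObjective C₁ q p, fun R hR =>
    hR.le_of_forall_cutsetObjective_le hC₁ hq (hQ hq) hmax⟩

lemma capacity_eq_of_forall [Nonempty X] (W : Channel X S Y Y₁) {C₁ : ℝ} (hC₁ : 0 ≤ C₁)
    {Q : Set (S → ℝ)} (hQ : Q ⊆ stdSimplex ℝ S) {v : ℝ} {q : S → ℝ} (hq : q ∈ Q)
    (hle : ∀ p ∈ stdSimplex ℝ X, W.cutsetObjective C₁ q p ≤ v)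
    (hach : ∀ R, 0 ≤ R → R < v → W.Achievable C₁ Q R) : W.capacity C₁ Q = v := by
  refine (isLUB_capacity W hC₁ hQ ⟨q, hq⟩).unique
    ⟨fun R hR => hR.le_of_forall_cutsetObjective_le hC₁ hq (hQ hq) hle, fun u hu => ?_⟩
  by_contra! hlt
  have hu0 : 0 ≤ u := hu (achievable_zero W hC₁ Q)
  obtain ⟨R, h1, h2⟩ := exists_between hlt
  exact absurd (hu (hach R (hu0.trans h1.le) h2)) (not_le.2 h1)

/-! ### Decode-forward for trivial and for full auxiliary variable -/

lemma sum_fst_mem {U : Type*} [Fintype U] {p : U × X → ℝ} (hp : p ∈ stdSimplex ℝ (U × X)) :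
    (fun x => ∑ u, p (u, x)) ∈ stdSimplex ℝ X :=
  ⟨fun x => Finset.sum_nonneg fun u _ => hp.1 (u, x), by
    rw [← hp.2, Fintype.sum_prod_type_right]⟩

lemma bddBelow_auxInfo {X S B U : Type*} [Fintype X] [Fintype B] [Fintype U] {Q : Set (S → ℝ)}
    {K : (S → ℝ) → X → B → ℝ} (hK : ∀ q ∈ Q, ∀ x, K q x ∈ stdSimplex ℝ B) {p : U × X → ℝ}
    (hp : p ∈ stdSimplex ℝ (U × X)) : BddBelow (Set.range fun q : Q => auxInfo p (K q.1)) :=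
  ⟨0, by rintro _ ⟨q, rfl⟩; exact auxInfo_nonneg hp (hK q q.2)⟩

lemma bddBelow_condInfo {X S B U : Type*} [Fintype X] [Fintype B] [Fintype U] {Q : Set (S → ℝ)}
    {K : (S → ℝ) → X → B → ℝ} (hK : ∀ q ∈ Q, ∀ x, K q x ∈ stdSimplex ℝ B) {p : U × X → ℝ}
    (hp : p ∈ stdSimplex ℝ (U × X)) : BddBelow (Set.range fun q : Q => condInfo p (K q.1)) :=
  ⟨0, by rintro _ ⟨q, rfl⟩; exact condInfo_nonneg hp.1 (hK q q.2)⟩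

/-- The decode-forward objective is at most its two terms evaluated at one state law, the first of
them simplified by the chain rule. -/
lemma dfObjective_le (W : Channel X S Y Y₁) (C₁ : ℝ) {Q : Set (S → ℝ)} (hQ : Q ⊆ stdSimplex ℝ S)
    {U : Type*} [Fintype U] {p : U × X → ℝ} (hp : p ∈ stdSimplex ℝ (U × X)) {q : S → ℝ}
    (hq : q ∈ Q) :
    W.dfObjective C₁ Q p ≤ min (channelInfo (fun x => ∑ u, p (u, x)) (W.avgY q) + C₁)
      (auxInfo p (W.avgY₁ q) + condInfo p (W.avgY q)) := by
  have h1 := ciInf_le (bddBelow_auxInfo (K := W.avgY) (fun q hq => avgY_mem W (hQ hq)) hp) ⟨q, hq⟩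
  have h2 := ciInf_le (bddBelow_auxInfo (K := W.avgY₁) (fun q hq => avgY₁_mem W (hQ hq)) hp)
    ⟨q, hq⟩
  have h3 := ciInf_le (bddBelow_condInfo (K := W.avgY) (fun q hq => avgY_mem W (hQ hq)) hp) ⟨q, hq⟩
  rw [← auxInfo_add_condInfo hp.1 (avgY_mem W (hQ hq))]
  exact min_le_min (by linarith) (by linarith)

lemma auxInfo_trivial {B : Type*} [Fintype B] {p : X → ℝ} (hp : p ∈ stdSimplex ℝ X) {K : X → B → ℝ}
    (hK : ∀ x, K x ∈ stdSimplex ℝ B) : auxInfo (fun z : Fin 1 × X => p z.2) K = 0 := by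
  have h := auxInfo_eq (p := fun z : Fin 1 × X => p z.2) (fun z => hp.1 z.2) hK
  have h0 : auxInfo (fun z : Fin 1 × X => p z.2) K * log 2 = 0 := by
    rw [h]
    simp [entropy, outLaw, Fintype.sum_prod_type, hp.2]
  exact (mul_eq_zero.1 h0).resolve_right (log_pos one_lt_two).ne'

lemma condInfo_trivial {B : Type*} [Fintype B] {p : X → ℝ} (hp : p ∈ stdSimplex ℝ X) {K : X → B → ℝ}
    (hK : ∀ x, K x ∈ stdSimplex ℝ B) :
    condInfo (fun z : Fin 1 × X => p z.2) K = channelInfo p K := by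
  have h := auxInfo_add_condInfo (p := fun z : Fin 1 × X => p z.2) (fun z => hp.1 z.2) hK
  rw [auxInfo_trivial hp hK, zero_add] at h
  simpa using h

open Classical in
/-- The joint law of `(U, X)` when `U` is a relabelling of `X`. -/
noncomputable def diagLaw {U : Type*} (e : U ≃ X) (p : X → ℝ) (z : U × X) : ℝ :=
  if e z.1 = z.2 then p z.2 else 0

section

variable {U : Type*} [Fintype U] (e : U ≃ X) {p : X → ℝ}

lemma sum_diagLaw_mul {X U : Type*} [Fintype X] (e : U ≃ X) {p : X → ℝ} (g : X → ℝ) (u : U) : ∑ x, diagLaw e p (u, x) * g x = p (e u) * g (e u) := by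
  classical
  simp [diagLaw, ite_mul]

lemma sum_diagLaw_left {X U : Type*} [Fintype U] (e : U ≃ X) {p : X → ℝ} (x : X) : ∑ u, diagLaw e p (u, x) = p x := by
  classical
  simp [diagLaw, ← Equiv.eq_symm_apply]

lemma diagLaw_mem (hp : p ∈ stdSimplex ℝ X) : diagLaw e p ∈ stdSimplex ℝ (U × X) := by
  refine ⟨fun z => by unfold diagLaw; split_ifs <;> [exact hp.1 _; exact le_rfl], ?_⟩
  rw [Fintype.sum_prod_type_right, ← hp.2]
  exact Finset.sum_congr rfl fun x _ => sum_diagLaw_left e x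

lemma condInfo_diagLaw {B : Type*} [Fintype B] (hp : p ∈ stdSimplex ℝ X) {K : X → B → ℝ}
    (hK : ∀ x, K x ∈ stdSimplex ℝ B) : condInfo (diagLaw e p) K = 0 := by
  have h0 : condInfo (diagLaw e p) K * log 2 = 0 := by
    rw [condInfo_eq (diagLaw_mem e hp).1 hK]
    have h1 : entropy (fun z : U × B => ∑ x, diagLaw e p (z.1, x) * K x z.2) =
        entropy (fun z : X × B => p z.1 * K z.1 z.2) := by
      simp only [entropy, Fintype.sum_prod_type, fun b => sum_diagLaw_mul e (p := p)
        (fun x => K x b)]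
      exact e.sum_comp fun x => ∑ b, negMulLog (p x * K x b)
    have h2 : entropy (fun u => ∑ x, diagLaw e p (u, x)) = entropy p := by
      have h3 : ∀ u, ∑ x, diagLaw e p (u, x) = p (e u) := fun u => by
        simpa using sum_diagLaw_mul e (p := p) (fun _ => 1) u
      simp only [entropy, h3]
      exact e.sum_comp fun x => negMulLog (p x)
    simp only [sum_diagLaw_left]
    rw [h1, h2, entropy_mul_channel hK]
    ring
  exact (mul_eq_zero.1 h0).resolve_right (log_pos one_lt_two).ne'

lemma auxInfo_diagLaw {B : Type*} [Fintype B] (hp : p ∈ stdSimplex ℝ X) {K : X → B → ℝ}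
    (hK : ∀ x, K x ∈ stdSimplex ℝ B) : auxInfo (diagLaw e p) K = channelInfo p K := by
  have h := auxInfo_add_condInfo (diagLaw_mem e hp).1 hK
  rw [condInfo_diagLaw e hp hK, add_zero] at h
  simpa only [sum_diagLaw_left] using h

end

/-! ### Degraded channels -/

lemma avgY_of_factor {X S Y Y₁ : Type*} [Fintype S] [Fintype Y] [Fintype Y₁]
    (W : Channel X S Y Y₁) {K : X → S → Y → ℝ} {V : Y → Y₁ → ℝ}
    (hV : ∀ y, V y ∈ stdSimplex ℝ Y₁) (hW : ∀ x s y y₁, W.W x s (y, y₁) = K x s y * V y y₁)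
    (q : S → ℝ) : W.avgY q = mixChannel K q := by
  funext x y
  rw [← mixChannel_receiver]
  simp only [mixChannel, Channel.receiver, hW]
  exact Finset.sum_congr rfl fun s _ => by rw [sum_mul_row hV (K x s) y]

lemma avg_of_factor {X S Y Y₁ : Type*} [Fintype S] [Fintype Y] [Fintype Y₁]
    (W : Channel X S Y Y₁) {K : X → S → Y → ℝ} {V : Y → Y₁ → ℝ}
    (hV : ∀ y, V y ∈ stdSimplex ℝ Y₁) (hW : ∀ x s y y₁, W.W x s (y, y₁) = K x s y * V y y₁)
    (q : S → ℝ) (x : X) (z : Y × Y₁) : W.avg q x z = W.avgY q x z.1 * V z.1 z.2 := by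
  rw [avgY_of_factor W hV hW]
  simp only [mixChannel, Channel.avg, Finset.sum_mul, mul_assoc]
  exact Finset.sum_congr rfl fun s _ => by rw [← hW]

lemma avg_of_factor' {X S Y Y₁ : Type*} [Fintype S] [Fintype Y] [Fintype Y₁]
    (W : Channel X S Y Y₁) {W₁ : X → Y₁ → ℝ} {V : Y₁ → S → Y → ℝ}
    (hW : ∀ x s y y₁, W.W x s (y, y₁) = W₁ x y₁ * V y₁ s y) (q : S → ℝ) (x : X) (z : Y × Y₁) :
    W.avg q x z = W₁ x z.2 * mixChannel V q z.2 z.1 := by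
  simp only [mixChannel, Channel.avg, Finset.mul_sum]
  exact Finset.sum_congr rfl fun s _ => by rw [hW x s z.1 z.2]; ring

end

section

variable {X S Y Y₁ : Type*} [Fintype X] [Fintype S] [Fintype Y] [Fintype Y₁]

/-! ### Saddle points of the information functionals -/

lemma bddAbove_channelInfo_input {B : Type*} [Fintype B] {K : X → B → ℝ}
    (hK : ∀ x, K x ∈ stdSimplex ℝ B) :
    BddAbove (Set.range fun p : stdSimplex ℝ X => channelInfo p.1 K) := by
  have := (isCompact_stdSimplex ℝ X).bddAbove_image (continuousOn_channelInfo_input hK)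
  rwa [Set.image_eq_range] at this

/-- Saddle point of `I_q(X;Y)`. -/
lemma exists_isSaddlePointOn_channelInfo [Nonempty X] (W : Channel X S Y Y₁)
    {Q : Set (S → ℝ)} (hQ : Q ⊆ stdSimplex ℝ S) (hQne : Q.Nonempty) (hQc : IsCompact Q)
    (hQconv : Convex ℝ Q) :
    ∃ a ∈ Q, ∃ b ∈ stdSimplex ℝ X,
      IsSaddlePointOn Q (stdSimplex ℝ X) (fun q p => channelInfo p (W.avgY q)) a b :=
  Sion.exists_isSaddlePointOn hQne hQconv hQc
    (fun _ hp => ((continuousOn_channelInfo_avgY W hp.1).mono hQ).lowerSemicontinuousOn)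
    (fun _ hp => ((convexOn_channelInfo_avgY W hp.1).subset hQ hQconv).quasiconvexOn)
    (convex_stdSimplex ℝ X) (nonempty_stdSimplex X) (isCompact_stdSimplex ℝ X)
    (fun _ hq => (continuousOn_channelInfo_input (avgY_mem W (hQ hq))).upperSemicontinuousOn)
    (fun _ hq => (concaveOn_channelInfo (avgY_mem W (hQ hq))).quasiconcaveOn)

/-- Saddle point of `min {I_q(X;Y) + C₁, I(X;Y₁)}`. As a minimum this is not convex in `q`, but it is
a monotone function of the convex function `I_q(X;Y)`, hence quasiconvex. -/
lemma exists_isSaddlePointOn_min [Nonempty X] (W : Channel X S Y Y₁) (C₁ : ℝ)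
    {Q : Set (S → ℝ)} (hQ : Q ⊆ stdSimplex ℝ S) (hQne : Q.Nonempty) (hQc : IsCompact Q)
    (hQconv : Convex ℝ Q) {W₁ : X → Y₁ → ℝ} (hW₁ : ∀ x, W₁ x ∈ stdSimplex ℝ Y₁) :
    ∃ a ∈ Q, ∃ b ∈ stdSimplex ℝ X, IsSaddlePointOn Q (stdSimplex ℝ X)
      (fun q p => min (channelInfo p (W.avgY q) + C₁) (channelInfo p W₁)) a b := by
  refine Sion.exists_isSaddlePointOn hQne hQconv hQc (fun p hp => ?_) (fun p hp => ?_)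
    (convex_stdSimplex ℝ X) (nonempty_stdSimplex X) (isCompact_stdSimplex ℝ X) (fun q hq => ?_)
    (fun q hq => ?_)
  · exact (ContinuousOn.inf (((continuousOn_channelInfo_avgY W hp.1).mono hQ).add
      continuousOn_const) continuousOn_const).lowerSemicontinuousOn
  · exact ((convexOn_channelInfo_avgY W hp.1).subset hQ hQconv).quasiconvexOn.monotone_comp
      (g := fun t => min (t + C₁) (channelInfo p W₁))
      fun t u h => min_le_min_right _ (by linarith)
  · exact (ContinuousOn.inf ((continuousOn_channelInfo_input (avgY_mem W (hQ hq))).add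
      continuousOn_const) (continuousOn_channelInfo_input hW₁)).upperSemicontinuousOn
  · exact (((concaveOn_channelInfo (avgY_mem W (hQ hq))).add_const C₁).inf
      (concaveOn_channelInfo hW₁)).quasiconcaveOn

/-! ### The two degraded cases -/

/-- In the reversely degraded case the relay is useless. -/
lemma cutsetObjective_of_reverselyStronglyDegraded (W : Channel X S Y Y₁) {C₁ : ℝ} (hC₁ : 0 ≤ C₁)
    {V : Y → Y₁ → ℝ} (hV : ∀ y, V y ∈ stdSimplex ℝ Y₁) {K : X → S → Y → ℝ}
    (hW : ∀ x s y y₁, W.W x s (y, y₁) = K x s y * V y y₁) {q : S → ℝ} (hq : q ∈ stdSimplex ℝ S)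
    (p : X → ℝ) : W.cutsetObjective C₁ q p = channelInfo p (W.avgY q) := by
  rw [Channel.cutsetObjective, channelInfo_eq_of_factor (avgY_mem W hq) hV (Equiv.refl _)
    (avg_of_factor W hV hW q), min_eq_right (by linarith)]

lemma avgY₁_of_reverselyStronglyDegraded {X S Y Y₁ : Type*} [Fintype S] [Fintype Y] [Fintype Y₁]
    (W : Channel X S Y Y₁)
    {V : Y → Y₁ → ℝ} (hV : ∀ y, V y ∈ stdSimplex ℝ Y₁) {K : X → S → Y → ℝ}
    (hW : ∀ x s y y₁, W.W x s (y, y₁) = K x s y * V y y₁) (q : S → ℝ) :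
    W.avgY₁ q = compChannel (W.avgY q) V := by
  funext x y₁
  simp only [Channel.avgY₁, compChannel, avg_of_factor W hV hW]

/-- In the degraded case the direct link adds nothing to the relay's observation. -/
lemma cutsetObjective_of_stronglyDegraded (W : Channel X S Y Y₁) (C₁ : ℝ)
    {W₁ : X → Y₁ → ℝ} (hW₁ : ∀ x, W₁ x ∈ stdSimplex ℝ Y₁) {V : Y₁ → S → Y → ℝ}
    (hV : ∀ y₁ s, V y₁ s ∈ stdSimplex ℝ Y)
    (hW : ∀ x s y y₁, W.W x s (y, y₁) = W₁ x y₁ * V y₁ s y) {q : S → ℝ} (hq : q ∈ stdSimplex ℝ S)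
    (p : X → ℝ) :
    W.cutsetObjective C₁ q p = min (channelInfo p (W.avgY q) + C₁) (channelInfo p W₁) := by
  rw [Channel.cutsetObjective, channelInfo_eq_of_factor hW₁ (mixChannel_mem hV hq)
    (Equiv.prodComm _ _) (avg_of_factor' W hW q)]

lemma avgY_of_stronglyDegraded {X S Y Y₁ : Type*} [Fintype S] [Fintype Y] [Fintype Y₁]
    (W : Channel X S Y Y₁) {W₁ : X → Y₁ → ℝ} {V : Y₁ → S → Y → ℝ}
    (hW : ∀ x s y y₁, W.W x s (y, y₁) = W₁ x y₁ * V y₁ s y) (q : S → ℝ) :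
    W.avgY q = compChannel W₁ (mixChannel V q) := by
  funext x y
  simp only [Channel.avgY, compChannel, avg_of_factor' W hW]

lemma avgY₁_of_stronglyDegraded {X S Y Y₁ : Type*} [Fintype S] [Fintype Y] [Fintype Y₁]
    (W : Channel X S Y Y₁) {W₁ : X → Y₁ → ℝ} {V : Y₁ → S → Y → ℝ}
    (hV : ∀ y₁ s, V y₁ s ∈ stdSimplex ℝ Y)
    (hW : ∀ x s y y₁, W.W x s (y, y₁) = W₁ x y₁ * V y₁ s y) {q : S → ℝ}
    (hq : q ∈ stdSimplex ℝ S) : W.avgY₁ q = W₁ := by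
  funext x y₁
  simp only [Channel.avgY₁, avg_of_factor' W hW]
  rw [← Finset.mul_sum, (mixChannel_mem hV hq y₁).2, mul_one]

theorem capacity_of_reverselyStronglyDegraded [Nonempty X] (W : Channel X S Y Y₁) {C₁ : ℝ}
    (hC₁ : 0 ≤ C₁) {Q : Set (S → ℝ)} (hQ : Q ⊆ stdSimplex ℝ S) (hQne : Q.Nonempty)
    (hQc : IsCompact Q) (hQconv : Convex ℝ Q) (hdeg : W.IsReverselyStronglyDegraded) :
    W.capacity C₁ Q = W.dfBound C₁ Q ∧
      W.dfBound C₁ Q = W.cutsetBound C₁ Q ∧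
      W.cutsetBound C₁ Q = ⨅ q : Q, ⨆ p : stdSimplex ℝ X, channelInfo p.1 (W.avgY q.1) ∧
      IsGreatest (W.dfValues C₁ Q) (W.dfBound C₁ Q) ∧
      (∀ q ∈ Q, ∃ p ∈ stdSimplex ℝ X,
        IsMaxOn (fun p => channelInfo p (W.avgY q)) (stdSimplex ℝ X) p) ∧
      (∃ q ∈ Q, IsMinOn (fun q => ⨆ p : stdSimplex ℝ X, channelInfo p.1 (W.avgY q)) Q q) := by
  obtain ⟨K, V, hK, hV, hW⟩ := hdeg
  obtain ⟨a, ha, b, hb, hsad⟩ := exists_isSaddlePointOn_channelInfo W hQ hQne hQc hQconv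
  set v := channelInfo b (W.avgY a) with hvdef
  have hobj : ∀ q ∈ Q, ∀ p, W.cutsetObjective C₁ q p = channelInfo p (W.avgY q) :=
    fun q hq p => cutsetObjective_of_reverselyStronglyDegraded W hC₁ hV hW (hQ hq) p
  have hmin : IsMinOn (fun q => ⨆ p : stdSimplex ℝ X, channelInfo p.1 (W.avgY q)) Q a :=
    IsSaddlePointOn.isMinOn_iSup hsad ha hb fun q hq =>
      bddAbove_channelInfo_input (avgY_mem W (hQ hq))
  have hinfsup : ⨅ q : Q, ⨆ p : stdSimplex ℝ X, channelInfo p.1 (W.avgY q.1) = v := by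
    rw [iInf_eq_of_isMinOn ha hmin]
    exact IsSaddlePointOn.iSup_eq hsad ha hb
  have hinf : ⨅ q : Q, channelInfo b (W.avgY q.1) = v := IsSaddlePointOn.iInf_eq hsad ha hb
  have hcut : W.cutsetBound C₁ Q = ⨅ q : Q, ⨆ p : stdSimplex ℝ X, channelInfo p.1 (W.avgY q.1) :=
    iInf_congr fun q => iSup_congr fun p => hobj q q.2 p
  have hgreat : IsGreatest (W.dfValues C₁ Q) v := by
    constructor
    · refine ⟨1, fun z => b z.2, ⟨fun z => hb.1 z.2, ?_⟩, ?_⟩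
      · rw [Fintype.sum_prod_type]; simpa using hb.2
      · have : Nonempty Q := hQne.to_subtype
        have h1 : ⨅ q : Q, auxInfo (fun z : Fin 1 × X => b z.2) (W.avgY q.1) = 0 := by
          simp only [fun q : Q => auxInfo_trivial hb (avgY_mem W (hQ q.2)), ciInf_const]
        have h2 : ⨅ q : Q, auxInfo (fun z : Fin 1 × X => b z.2) (W.avgY₁ q.1) = 0 := by
          simp only [fun q : Q => auxInfo_trivial hb (avgY₁_mem W (hQ q.2)), ciInf_const]
        have h3 : ⨅ q : Q, condInfo (fun z : Fin 1 × X => b z.2) (W.avgY q.1) = v := by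
          simp only [fun q : Q => condInfo_trivial hb (avgY_mem W (hQ q.2)), hinf]
        rw [Channel.dfObjective, h1, h2, h3, zero_add, min_eq_right (by linarith)]
    · rintro _ ⟨k, p, hp, rfl⟩
      refine (dfObjective_le W C₁ hQ hp ha).trans ((min_le_right _ _).trans ?_)
      have h1 := auxInfo_comp_le hp.1 (avgY_mem W (hQ ha)) hV
      rw [← avgY₁_of_reverselyStronglyDegraded W hV hW a] at h1
      have h2 := auxInfo_add_condInfo hp.1 (avgY_mem W (hQ ha))
      have h3 : channelInfo (fun x => ∑ u, p (u, x)) (W.avgY a) ≤ v :=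
        hsad a ha _ (sum_fst_mem hp)
      linarith
  have hdf : W.dfBound C₁ Q = v := hgreat.csSup_eq
  have hcap : W.capacity C₁ Q = v := by
    refine capacity_eq_of_forall W hC₁ hQ ha (fun p hp => ?_) fun R hR hRv => ?_
    · rw [hobj a ha]; exact hsad a ha p hp
    · exact achievable_of_lt_channelInfo W hC₁ hQ hQne hQc hb hR hRv fun q hq => hsad q hq b hb
  refine ⟨hcap.trans hdf.symm, hdf.trans (hcut.trans hinfsup).symm, hcut, hdf ▸ hgreat,
    fun q hq => ?_, a, ha, hmin⟩
  exact (isCompact_stdSimplex ℝ X).exists_isMaxOn (nonempty_stdSimplex X)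
    (continuousOn_channelInfo_input (avgY_mem W (hQ hq)))

theorem capacity_of_stronglyDegraded [Nonempty X] (W : Channel X S Y Y₁) {C₁ : ℝ}
    (hC₁ : 0 ≤ C₁) {Q : Set (S → ℝ)} (hQ : Q ⊆ stdSimplex ℝ S) (hQne : Q.Nonempty)
    (hQc : IsCompact Q) (hQconv : Convex ℝ Q) (W₁ : X → Y₁ → ℝ)
    (hdeg : W.IsStronglyDegradedWith W₁) :
    W.capacity C₁ Q = W.dfBound C₁ Q ∧
      W.dfBound C₁ Q = W.cutsetBound C₁ Q ∧
      W.cutsetBound C₁ Q = ⨆ p : stdSimplex ℝ X,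
        min ((⨅ q : Q, channelInfo p.1 (W.avgY q.1)) + C₁) (channelInfo p.1 W₁) ∧
      IsGreatest (W.dfValues C₁ Q) (W.dfBound C₁ Q) ∧
      (∀ p ∈ stdSimplex ℝ X, ∃ q ∈ Q, IsMinOn (fun q => channelInfo p (W.avgY q)) Q q) ∧
      (∃ p ∈ stdSimplex ℝ X,
        IsMaxOn (fun p => min ((⨅ q : Q, channelInfo p (W.avgY q.1)) + C₁) (channelInfo p W₁))
          (stdSimplex ℝ X) p) := by
  obtain ⟨hW₁, V, hV, hW⟩ := hdeg
  obtain ⟨a, ha, b, hb, hsad⟩ := exists_isSaddlePointOn_min W C₁ hQ hQne hQc hQconv hW₁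
  have : Nonempty Q := hQne.to_subtype
  set f : (S → ℝ) → (X → ℝ) → ℝ :=
    fun q p => min (channelInfo p (W.avgY q) + C₁) (channelInfo p W₁) with hf
  set v := f a b with hvdef
  have hobj : ∀ q ∈ Q, ∀ p, W.cutsetObjective C₁ q p = f q p :=
    fun q hq p => cutsetObjective_of_stronglyDegraded W C₁ hW₁ hV hW (hQ hq) p
  have hbelow : ∀ p ∈ stdSimplex ℝ X,
      BddBelow (Set.range fun q : Q => channelInfo p (W.avgY q.1)) := fun p hp =>
    ⟨0, by rintro _ ⟨q, rfl⟩; exact channelInfo_nonneg hp (avgY_mem W (hQ q.2))⟩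
  -- `t ↦ min (t + C₁) c` is monotone and continuous, so it commutes with the infimum
  have hinf : ∀ p ∈ stdSimplex ℝ X,
      min ((⨅ q : Q, channelInfo p (W.avgY q.1)) + C₁) (channelInfo p W₁) = ⨅ q : Q, f q p := by
    intro p hp
    have hcont : Continuous fun t : ℝ => min (t + C₁) (channelInfo p W₁) := by fun_prop
    exact Monotone.map_ciInf_of_continuousAt (f := fun t => min (t + C₁) (channelInfo p W₁))
      hcont.continuousAt (fun t u h => min_le_min_right _ (by linarith)) (hbelow p hp)
  have hfabove : ∀ q ∈ Q, BddAbove (Set.range fun p : stdSimplex ℝ X => f q p.1) := fun q _ => by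
    obtain ⟨u, hu⟩ := bddAbove_channelInfo_input hW₁
    exact ⟨u, by rintro _ ⟨p, rfl⟩; exact (min_le_right _ _).trans (hu ⟨p, rfl⟩)⟩
  have hfbelow : ∀ p ∈ stdSimplex ℝ X, BddBelow (Set.range fun q : Q => f q p) := fun p hp =>
    ⟨0, by
      rintro _ ⟨q, rfl⟩
      exact le_min (add_nonneg (channelInfo_nonneg hp (avgY_mem W (hQ q.2))) hC₁)
        (channelInfo_nonneg hp hW₁)⟩
  have hmax : IsMaxOn (fun p => min ((⨅ q : Q, channelInfo p (W.avgY q.1)) + C₁)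
      (channelInfo p W₁)) (stdSimplex ℝ X) b := by
    refine isMaxOn_iff.2 fun p hp => ?_
    rw [hinf p hp, hinf b hb]
    exact isMaxOn_iff.1 (IsSaddlePointOn.isMaxOn_iInf hsad ha hb hfbelow) p hp
  have hval : min ((⨅ q : Q, channelInfo b (W.avgY q.1)) + C₁) (channelInfo b W₁) = v :=
    (hinf b hb).trans (IsSaddlePointOn.iInf_eq hsad ha hb)
  have hsup : ⨆ p : stdSimplex ℝ X,
      min ((⨅ q : Q, channelInfo p.1 (W.avgY q.1)) + C₁) (channelInfo p.1 W₁) = v :=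
    (iSup_eq_of_isMaxOn hb hmax).trans hval
  have hcut : W.cutsetBound C₁ Q = v := by
    have h1 : W.cutsetBound C₁ Q = ⨅ q : Q, ⨆ p : stdSimplex ℝ X, f q p.1 :=
      iInf_congr fun q => iSup_congr fun p => hobj q q.2 p
    rw [h1, iInf_eq_of_isMinOn ha (IsSaddlePointOn.isMinOn_iSup hsad ha hb hfabove)]
    exact IsSaddlePointOn.iSup_eq hsad ha hb
  have hgreat : IsGreatest (W.dfValues C₁ Q) v := by
    constructor
    · let e := (Fintype.equivFin X).symm
      refine ⟨Fintype.card X, diagLaw e b, diagLaw_mem e hb, ?_⟩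
      have h1 : ∀ q : Q, auxInfo (diagLaw e b) (W.avgY₁ q.1) = channelInfo b W₁ := fun q => by
        rw [avgY₁_of_stronglyDegraded W hV hW (hQ q.2), auxInfo_diagLaw e hb hW₁]
      simp only [Channel.dfObjective, h1,
        fun q : Q => auxInfo_diagLaw e hb (avgY_mem W (hQ q.2)),
        fun q : Q => condInfo_diagLaw e hb (avgY_mem W (hQ q.2)), ciInf_const, add_zero, hval]
    · rintro _ ⟨k, p, hp, rfl⟩
      have h1 := condInfo_comp_le hp.1 hW₁ (mixChannel_mem hV (hQ ha))
      rw [← avgY_of_stronglyDegraded W hW a] at h1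
      have h2 := auxInfo_add_condInfo hp.1 hW₁
      refine (dfObjective_le W C₁ hQ hp ha).trans (le_trans ?_ (hsad a ha _ (sum_fst_mem hp)))
      refine min_le_min_left _ ?_
      rw [avgY₁_of_stronglyDegraded W hV hW (hQ ha)]
      linarith
  have hdf : W.dfBound C₁ Q = v := hgreat.csSup_eq
  have hcap : W.capacity C₁ Q = v := by
    refine capacity_eq_of_forall W hC₁ hQ ha (fun p hp => ?_) fun R hR hRv => ?_
    · rw [hobj a ha]; exact hsad a ha p hp
    · refine achievable_of_lt_relay W hC₁ hQ hQne hQc hb hR hRv (fun q hq => ?_) fun q hq => ?_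
      · exact (hsad q hq b hb).trans (min_le_left _ _)
      · rw [avgY₁_of_stronglyDegraded W hV hW (hQ hq)]
        exact (hsad q hq b hb).trans (min_le_right _ _)
  refine ⟨hcap.trans hdf.symm, hdf.trans hcut.symm, hcut.trans hsup.symm, hdf ▸ hgreat,
    fun p hp => ?_, b, hb, hmax⟩
  exact hQc.exists_isMinOn hQne ((continuousOn_channelInfo_avgY W hp.1).mono hQ)

end

end PrimRelay

theorem corollary1 {X S Y Y₁ : Type*} [Fintype X] [Fintype S] [Fintype Y] [Fintype Y₁]
    [Nonempty X] (W : Channel X S Y Y₁) (C₁ : ℝ) (hC₁ : 0 ≤ C₁)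
    (Q : Set (S → ℝ)) (hQ : Q ⊆ stdSimplex ℝ S) (hQne : Q.Nonempty)
    (hQcompact : IsCompact Q) (hQconvex : Convex ℝ Q) :
    -- the operational capacity and the maxima in the cutset bound are well defined
    IsLUB {R | W.Achievable C₁ Q R} (W.capacity C₁ Q) ∧
    (∀ q ∈ Q, ∃ p ∈ stdSimplex ℝ X,
      IsMaxOn (fun p => W.cutsetObjective C₁ q p) (stdSimplex ℝ X) p) ∧
    -- part 1
    (W.IsReverselyStronglyDegraded →
      W.capacity C₁ Q = W.dfBound C₁ Q ∧
      W.dfBound C₁ Q = W.cutsetBound C₁ Q ∧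
      W.cutsetBound C₁ Q = ⨅ q : Q, ⨆ p : stdSimplex ℝ X, channelInfo p.1 (W.avgY q.1) ∧
      -- the maxima and the minimum are attained
      IsGreatest (W.dfValues C₁ Q) (W.dfBound C₁ Q) ∧
      (∀ q ∈ Q, ∃ p ∈ stdSimplex ℝ X,
        IsMaxOn (fun p => channelInfo p (W.avgY q)) (stdSimplex ℝ X) p) ∧
      (∃ q ∈ Q, IsMinOn (fun q => ⨆ p : stdSimplex ℝ X, channelInfo p.1 (W.avgY q)) Q q)) ∧
    -- part 2
    (∀ W₁ : X → Y₁ → ℝ, W.IsStronglyDegradedWith W₁ →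
      W.capacity C₁ Q = W.dfBound C₁ Q ∧
      W.dfBound C₁ Q = W.cutsetBound C₁ Q ∧
      W.cutsetBound C₁ Q = ⨆ p : stdSimplex ℝ X,
        min ((⨅ q : Q, channelInfo p.1 (W.avgY q.1)) + C₁) (channelInfo p.1 W₁) ∧
      -- the maxima and the minima are attained
      IsGreatest (W.dfValues C₁ Q) (W.dfBound C₁ Q) ∧
      (∀ p ∈ stdSimplex ℝ X, ∃ q ∈ Q, IsMinOn (fun q => channelInfo p (W.avgY q)) Q q) ∧
      (∃ p ∈ stdSimplex ℝ X,
        IsMaxOn (fun p => min ((⨅ q : Q, channelInfo p (W.avgY q.1)) + C₁) (channelInfo p W₁))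
          (stdSimplex ℝ X) p)) := by
  refine ⟨isLUB_capacity W hC₁ hQ hQne,
    fun q hq => exists_isMaxOn_cutsetObjective W C₁ (hQ hq),
    capacity_of_reverselyStronglyDegraded W hC₁ hQ hQne hQcompact hQconvex,
    capacity_of_stronglyDegraded W hC₁ hQ hQne hQcompact hQconvex⟩
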